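/- \textbf{Setting.} Let $N, M$ be natural numbers, $k_1,\dots,k_M$ and $\theta_{01},\dots,\theta_{0M}$ real numbers, $A=(a_{nm})$ a real $N\times M$ matrix, $\theta_m=k_mx+k_m^2y+k_m^3t+\theta_{0m}$, $f_n=\sum_m a_{nm}e^{\theta_m}$, $\tau=\mathrm{Wr}_x(f_1,\dots,f_N)$ and $u=2(\log\tau)_{xx}$. Call the data admissible if $k_1<\dots<k_M$, $M>N$, $\operatorname{rank}A=N$, all nonzero $N\times N$ minors $A(m_1,\dots,m_N)$ $(m_1<\dots<m_N)$ are positive, $A$ is in reduced row-echelon form, and $A$ is irreducible (each column has a nonzero entry and each row has a nonzero entry besides its pivot). Let $\Theta$ be the set of phase combinations $\theta(m_1,\dots,m_N)=\theta_{m_1}+\dots+\theta_{m_N}$ that have nonzero coefficient $A(m_1,\dots,m_N)\prod_{s<r}(k_{m_r}-k_{m_s})$ in the expansion of $\tau$; the $\theta_m$ are treated here as formal symbols. Two $\tau$-functions with the same phase parameters $k_1,\dots,k_M$ are in the same equivalence class if they have the same $\Theta$ up to an overall exponential phase factor (that is, up to adding one fixed combination $\sum_m c_m\theta_m$ to all elements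 of $\Theta$); the functions $u$ generated by the admissible data in a class form an equivalence class of solutions. Two classes with the same phase parameters are dual if the set of phase combinations of one consists of the complementary combinations (complementary index sets in $\{1,\dots,M\}$) of those of the other, up to an overall factor. Admissible data and the solution $u$ are called elastic if their class is its own dual. The single-phase transition $i\to j$ ($i<j$) occurs as $y\to\pm\infty$ if there are $\theta(i,m_2,\dots,m_N)$ and $\theta(j,m_2,\dots,m_N)$ in $\Theta$ which, for each fixed $t$, are dominant along the line $\theta_i=\theta_j$ as $y\to\pm\infty$ (no element of $\Theta$ exceeds them by an unbounded amount). The function $u$ has an asymptotic line soliton of amplitude $a>0$ and direction $c$ as $y\to\pm\infty$ if for some real $\delta$ and all $t$, with $k^\pm=(c\pm a)/2$ and $\vartheta^\pm=k^\pm x+(k^\pm)^2y+(k^\pm)^3t$, one has $u-\tfrac12a^2\operatorname{sech}^2\big[\tfrac12(\vartheta^+-\vartheta^-+\delta)\big]\to0$ as $y\to\pm\infty$ along the lines $x+cy=\xi$, locally uniformly in $\xi\in\mathbb R$. For $i<j$, the pair $[i,j]$ labels an asymptotic line soliton if this holds with $a=k_j-k_i$ and $c=k_j+k_i$. \textbf{Proposition.}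 Let admissible data be given. (1) The data are elastic if and only if $M=2N$ and, for all disjoint partitions $\{m_1,\dots,m_N\}\sqcup\{l_1,\dots,l_N\}=\{1,\dots,2N\}$, $A(m_1,\dots,m_N)=0\Leftrightarrow A(l_1,\dots,l_N)=0$. Suppose now that the data are elastic. (2) The solution $u(x,y,t)$ and the dual solution $u(-x,-y,-t)$ belong to the same equivalence class of solutions, namely that of the given data. (3) There are index pairs $[e_n,g_n]$, $e_n<g_n$, $n=1,\dots,N$, where $e_1<\dots<e_N$ are exactly the pivot columns of $A$ and $g_1,\dots,g_N$ are distinct and exactly the non-pivot columns, so that together they form a disjoint partition of $\{1,\dots,2N\}$, such that the single-phase transitions which occur as $y\to+\infty$, and also those which occur as $y\to-\infty$, are exactly these $N$ transitions $e_n\to g_n$. If the phase parameters are generic in the sense that the $N$ directions $k_{e_n}+k_{g_n}$ are distinct, then the index pairs that label asymptotic line solitons of $u$ are exactly these $N$ pairs $[e_n,g_n]$ as $y\to+\infty$, and exactly the same $N$ pairs as $y\to-\infty$. (4) With the same pairs and for generic phase parameters in this sense, the (amplitude, direction) pairs of the asymptotic line solitons of $u$ are exactly $(k_{g_n}-k_{e_n},\,k_{g_n}+k_{e_n})$,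 $n=1,\dots,N$, both as $y\to+\infty$ and as $y\to-\infty$. -/

import Mathlib

open Filter Topology

noncomputable section

namespace KPII

/-- The linear phase `κ x + κ² y + κ³ t` with phase parameter `κ`. -/
def linPhase (κ x y t : ℝ) : ℝ := κ * x + κ ^ 2 * y + κ ^ 3 * t

/-- The one-soliton solution `½ (q - p)² sech² (½ (phase q - phase p + δ))` with phase
parameters `p`, `q`; its amplitude is `q - p`, its direction is `p + q`. -/
def lineSoliton (p q δ x y t : ℝ) : ℝ :=
  1 / 2 * (q - p) ^ 2 /
    Real.cosh (1 / 2 * (linPhase q x y t - linPhase p x y t + δ)) ^ 2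

/-- `u` has, as `y → ±∞` (`l = atTop` or `l = atBot`), an asymptotic line soliton of amplitude
`a > 0` and direction `c`: at every time, in a neighbourhood of the lines `x + c y = ξ`, the
function `u` is asymptotic to a line soliton with phase parameters `(c - a) / 2`, `(c + a) / 2`
(that is, amplitude `a` and direction `c`) and some fixed position `δ`. -/
def HasLineSoliton (u : ℝ → ℝ → ℝ → ℝ) (l : Filter ℝ) (a c : ℝ) : Prop :=
  0 < a ∧ ∃ δ : ℝ, ∀ t : ℝ,
    TendstoLocallyUniformly
      (fun y ξ : ℝ => u (ξ - c * y) y t -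
        lineSoliton ((c - a) / 2) ((c + a) / 2) δ (ξ - c * y) y t)
      (fun _ => 0) l

section Matrices

variable {N M : ℕ}

/-- The maximal minor of `A` with columns `m 0 < ⋯ < m (N - 1)`. -/
def minor (A : Matrix (Fin N) (Fin M) ℝ) (m : Fin N ↪o Fin M) : ℝ :=
  (A.submatrix id m).det

/-- The entry in row `n` and column `m` is the leftmost nonzero entry of row `n`. -/
def IsLeading (A : Matrix (Fin N) (Fin M) ℝ) (n : Fin N) (m : Fin M) : Prop :=
  A n m ≠ 0 ∧ ∀ m' < m, A n m' = 0

/-- Column `m` is a pivot column (for matrices in reduced row-echelon form). -/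
def IsPivot (A : Matrix (Fin N) (Fin M) ℝ) (m : Fin M) : Prop :=
  ∃ n, IsLeading A n m

/-- Reduced row-echelon form. -/
structure IsRREF (A : Matrix (Fin N) (Fin M) ℝ) : Prop where
  leading_eq_one : ∀ n m, IsLeading A n m → A n m = 1
  zero_off_pivot : ∀ n m, IsLeading A n m → ∀ n', n' ≠ n → A n' m = 0
  staircase : ∀ n n' m m', n < n' → IsLeading A n m → IsLeading A n' m' → m < m'
  zero_rows_last : ∀ n n', n < n' → (∀ m, A n m = 0) → ∀ m, A n' m = 0

/-- Irreducibility: every column has a nonzero entry, and every row has a nonzero entry in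
addition to its pivot. -/
structure IsIrreducible (A : Matrix (Fin N) (Fin M) ℝ) : Prop where
  col : ∀ m, ∃ n, A n m ≠ 0
  row : ∀ n, ∃ m, A n m ≠ 0 ∧ ¬ IsLeading A n m

/-- Two maximal minors with complementary column sets vanish simultaneously. -/
def MinorDuality (A : Matrix (Fin N) (Fin M) ℝ) : Prop :=
  ∀ m l : Fin N ↪o Fin M, IsCompl (Set.range m) (Set.range l) →
    (minor A m = 0 ↔ minor A l = 0)

end Matrices

section PhaseSets

variable {M : ℕ}

/-- The formal exponent of `exp (θ(S))`, `θ(S) = ∑ m ∈ S, θ m`, in the phases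
`θ 0, …, θ (M - 1)`. -/
def exponent (S : Finset (Fin M)) : Fin M → ℝ := fun m => if m ∈ S then 1 else 0

/-- Two sets of phase combinations agree up to an overall exponential phase factor
`exp (∑ m, c m * θ m)`. -/
def SameUpToFactor (Θ Θ' : Set (Finset (Fin M))) : Prop :=
  ∃ c : Fin M → ℝ, (fun S => exponent S + c) '' Θ = exponent '' Θ'

end PhaseSets

/-- The parameters of a `τ`-function: phase parameters `k`, phase constants `θ₀`, and the
`N × M` coefficient matrix `A`. -/
structure TauData (N M : ℕ) where
  k : Fin M → ℝ
  θ₀ : Fin M → ℝ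
  A : Matrix (Fin N) (Fin M) ℝ

namespace TauData

variable {N N' M : ℕ}

/-- The phase `θ m = k m x + (k m)² y + (k m)³ t + θ₀ m`. -/
def phase (D : TauData N M) (m : Fin M) (x y t : ℝ) : ℝ :=
  linPhase (D.k m) x y t + D.θ₀ m

/-- The phase combination `θ(S) = ∑ m ∈ S, θ m`. -/
def phaseSum (D : TauData N M) (S : Finset (Fin M)) (x y t : ℝ) : ℝ :=
  ∑ m ∈ S, D.phase m x y t

/-- The function `f n = ∑ m, a n m * exp (θ m)`. -/
def f (D : TauData N M) (n : Fin N) (x y t : ℝ) : ℝ :=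
  ∑ m, D.A n m * Real.exp (D.phase m x y t)

/-- The `τ`-function, the Wronskian in `x` of the functions `f n`. -/
def tau (D : TauData N M) (x y t : ℝ) : ℝ :=
  (Matrix.of fun j n : Fin N => iteratedDeriv (j : ℕ) (fun x' => D.f n x' y t) x).det

/-- The function `u = 2 (log τ)_xx`. -/
def sol (D : TauData N M) (x y t : ℝ) : ℝ :=
  2 * iteratedDeriv 2 (fun x' => Real.log (D.tau x' y t)) x

/-- The standing assumptions on the parameters: ordered distinct phase parameters, more columns
than rows, full rank, positive nonzero maximal minors, reduced row-echelon form, and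
irreducibility. -/
structure Admissible (D : TauData N M) : Prop where
  strictMono : StrictMono D.k
  lt : N < M
  rank : D.A.rank = N
  minor_pos : ∀ m : Fin N ↪o Fin M, minor D.A m ≠ 0 → 0 < minor D.A m
  rref : IsRREF D.A
  irreducible : IsIrreducible D.A

/-- The coefficient of `exp (θ(m 0, …, m (N - 1)))` in the expansion of the `τ`-function. -/
def coeff (D : TauData N M) (m : Fin N ↪o Fin M) : ℝ :=
  minor D.A m * ∏ s : Fin N, ∏ r ∈ Finset.Ioi s, (D.k (m r) - D.k (m s))

/-- The set `Θ` of the phase combinations whose coefficient in the `τ`-function is nonzero; a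
phase combination is recorded by its set of indices. -/
def phaseSet (D : TauData N M) : Set (Finset (Fin M)) :=
  {S | ∃ m : Fin N ↪o Fin M, D.coeff m ≠ 0 ∧ Finset.univ.map m.toEmbedding = S}

/-- `D` and `D'` lie in the same equivalence class: same phase parameters, and the same set of
phase combinations up to an overall exponential phase factor. -/
def Equivalent (D : TauData N M) (D' : TauData N' M) : Prop :=
  D.k = D'.k ∧ SameUpToFactor D.phaseSet D'.phaseSet

/-- The equivalence classes of `D` and `D'` are dual: same phase parameters, and complementary
sets of phase combinations (up to an overall exponential phase factor, so that this depends only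
on the two classes). -/
def IsDual (D : TauData N M) (D' : TauData N' M) : Prop :=
  D.k = D'.k ∧ SameUpToFactor ((fun S => Sᶜ) '' D.phaseSet) D'.phaseSet

/-- `D` is elastic: its equivalence class is its own dual. -/
def IsElastic (D : TauData N M) : Prop := D.IsDual D

/-- The equivalence class of solutions generated by the equivalence class of `D`. -/
def solutionClass (D : TauData N M) : Set (ℝ → ℝ → ℝ → ℝ) :=
  {u | ∃ (N' : ℕ) (D' : TauData N' M), D'.Admissible ∧ D.Equivalent D' ∧ u = D'.sol}

/-- The single-phase transition `i → j` (`i < j`) occurs as `y → ±∞`: there are two phase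
combinations `θ(i, S)`, `θ(j, S)` in `Θ` which differ by a single phase and which, along
the line `θ i = θ j`, are dominant, that is, no phase combination in `Θ` exceeds them by more
than a bounded amount. -/
def IsTransition (D : TauData N M) (l : Filter ℝ) (i j : Fin M) : Prop :=
  i < j ∧ ∃ S : Finset (Fin M), i ∉ S ∧ j ∉ S ∧
    insert i S ∈ D.phaseSet ∧ insert j S ∈ D.phaseSet ∧
    ∀ T ∈ D.phaseSet, ∀ t : ℝ, ∃ C : ℝ, ∀ᶠ y in l, ∀ x : ℝ,
      D.phase i x y t = D.phase j x y t →
        D.phaseSum T x y t ≤ D.phaseSum (insert i S) x y t + C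

/-- The index pair `[i, j]` (`i < j`) labels an asymptotic line soliton of `u` as `y → ±∞`,
namely one of amplitude `k j - k i` and direction `k j + k i`. -/
def IsAsymptoticLineSoliton (D : TauData N M) (l : Filter ℝ) (i j : Fin M) : Prop :=
  i < j ∧ HasLineSoliton D.sol l (D.k j - D.k i) (D.k j + D.k i)

end TauData

end KPII

end

noncomputable section

/-! ### Cauchy–Binet and the exponential expansion of `τ`. -/

namespace KPII

/-- The Cauchy–Binet formula. -/
theorem det_mul_eq_sum_minors {N M : ℕ} (X : Matrix (Fin N) (Fin M) ℝ)
    (Y : Matrix (Fin M) (Fin N) ℝ) :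
    (X * Y).det = ∑ S : Finset (Fin M), if h : S.card = N then
      (X.submatrix id (S.orderEmbOfFin h)).det * (Y.submatrix (S.orderEmbOfFin h) id).det
      else 0 := by
  have h1 : (X * Y).det = ∑ p : Fin N → Fin M,
      (∏ i, Y (p i) i) * (X.submatrix id p).det := by
    simp only [Matrix.det_apply', Matrix.mul_apply, Finset.prod_univ_sum, Finset.mul_sum,
      Fintype.piFinset_univ]
    rw [Finset.sum_comm]
    refine Finset.sum_congr rfl fun p _ => Finset.sum_congr rfl fun σ _ => ?_
    simp only [Finset.prod_mul_distrib, Matrix.submatrix_apply, id]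
    ring
  -- Group the column choices `p` by image: an image of size `N` leaves the orderings of that set,
  -- and a smaller image forces a repeated column.
  rw [h1, ← Finset.sum_fiberwise (s := Finset.univ)
    (g := fun p : Fin N → Fin M => Finset.univ.image p)]
  refine Finset.sum_congr rfl fun S _ => ?_
  split_ifs with h
  · have h2 : ∑ σ : Equiv.Perm (Fin N), (∏ i, Y (S.orderEmbOfFin h (σ i)) i) *
        (X.submatrix id (S.orderEmbOfFin h ∘ σ)).det =
        ∑ p with Finset.univ.image p = S, (∏ i, Y (p i) i) * (X.submatrix id p).det := by
      refine Finset.sum_bij (fun σ _ => S.orderEmbOfFin h ∘ σ) ?_ ?_ ?_ ?_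
      · intro σ _
        simp only [Finset.mem_filter, Finset.mem_univ, true_and]
        rw [← Finset.image_image, Finset.image_univ_equiv, Finset.image_orderEmbOfFin_univ]
      · intro σ _ σ' _ hσ
        refine Equiv.ext fun i => ?_
        have := congrFun hσ i
        simpa using this
      · intro p hp
        simp only [Finset.mem_filter, Finset.mem_univ, true_and] at hp
        have hinj : Function.Injective p := by
          rw [← Set.injOn_univ, ← Finset.coe_univ, ← Finset.card_image_iff, hp, h]
          simp
        have hmem : ∀ i, p i ∈ S := fun i => hp ▸ Finset.mem_image_of_mem p (Finset.mem_univ i)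
        let q : Fin N → Fin N := fun i => (S.orderIsoOfFin h).symm ⟨p i, hmem i⟩
        have hq : ∀ i, S.orderEmbOfFin h (q i) = p i := fun i => by
          rw [← Finset.coe_orderIsoOfFin_apply]; simp [q]
        have hqi : Function.Injective q := fun i j hij => hinj (by rw [← hq, ← hq, hij])
        refine ⟨Equiv.ofBijective q (Finite.injective_iff_bijective.1 hqi), Finset.mem_univ _, ?_⟩
        ext i
        simp [hq]
      · intro σ _; rfl
    rw [← h2, Matrix.det_apply' (Y.submatrix _ _), Finset.mul_sum]
    refine Finset.sum_congr rfl fun σ _ => ?_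
    have : X.submatrix id (S.orderEmbOfFin h ∘ σ) =
        (X.submatrix id (S.orderEmbOfFin h)).submatrix id σ := rfl
    rw [this, Matrix.det_permute']
    simp only [Matrix.submatrix_apply, id]
    ring
  · refine Finset.sum_eq_zero fun p hp => ?_
    simp only [Finset.mem_filter, Finset.mem_univ, true_and] at hp
    have : ¬ Function.Injective p := fun hinj => h (by
      rw [← hp, Finset.card_image_of_injective _ hinj]; simp)
    simp only [Function.Injective, not_forall] at this
    obtain ⟨i, j, hij, hne⟩ := this
    rw [Matrix.det_zero_of_column_eq hne (fun k => by simp [hij]), mul_zero]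

/-- The Vandermonde product of the parameters `k` over the columns `m`. -/
def vander {N M : ℕ} (k : Fin M → ℝ) (m : Fin N → Fin M) : ℝ :=
  ∏ s : Fin N, ∏ r ∈ Finset.Ioi s, (k (m r) - k (m s))

theorem vander_pos {N M : ℕ} {k : Fin M → ℝ} (hk : StrictMono k) {m : Fin N → Fin M}
    (hm : StrictMono m) : 0 < vander k m :=
  Finset.prod_pos fun _ _ => Finset.prod_pos fun _ hr =>
    sub_pos.2 (hk (hm (Finset.mem_Ioi.1 hr)))

theorem vander_eq_det {N M : ℕ} (k : Fin M → ℝ) (m : Fin N → Fin M) :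
    vander k m = (Matrix.of fun j i : Fin N => k (m i) ^ (j : ℕ)).det := by
  rw [← Matrix.det_transpose]
  exact (Matrix.det_vandermonde (fun i => k (m i))).symm

namespace TauData

variable {N M : ℕ} (D : TauData N M)

/-- The coefficient of `exp (θ(S))` in the `τ`-function, indexed by finite sets. -/
def setCoeff (S : Finset (Fin M)) : ℝ :=
  if h : S.card = N then D.coeff (S.orderEmbOfFin h) else 0

theorem card_of_setCoeff_ne_zero {S : Finset (Fin M)} (h : D.setCoeff S ≠ 0) : S.card = N := by
  by_contra h'
  exact h (by simp [setCoeff, h'])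

theorem orderEmbOfFin_map_univ (m : Fin N ↪o Fin M)
    (h : (Finset.univ.map m.toEmbedding).card = N) :
    (Finset.univ.map m.toEmbedding).orderEmbOfFin h = m :=
  (Finset.orderEmbOfFin_unique' h fun x => by simp).symm

theorem setCoeff_map (m : Fin N ↪o Fin M) :
    D.setCoeff (Finset.univ.map m.toEmbedding) = D.coeff m := by
  have h : (Finset.univ.map m.toEmbedding).card = N := by simp
  rw [setCoeff, dif_pos h, orderEmbOfFin_map_univ]

theorem mem_phaseSet_iff {S : Finset (Fin M)} : S ∈ D.phaseSet ↔ D.setCoeff S ≠ 0 := by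
  constructor
  · rintro ⟨m, hm, rfl⟩
    rwa [setCoeff_map]
  · intro h
    have hc := D.card_of_setCoeff_ne_zero h
    refine ⟨S.orderEmbOfFin hc, ?_, by simp⟩
    simpa [setCoeff, hc] using h

theorem iteratedDeriv_f (n : Fin N) (x y t : ℝ) (j : ℕ) :
    iteratedDeriv j (fun x' => D.f n x' y t) x =
      ∑ m, D.k m ^ j * Real.exp (D.phase m x y t) * D.A n m := by
  induction j generalizing x with
  | zero => simp [f, mul_comm]
  | succ j ih =>
    rw [iteratedDeriv_succ, funext ih]
    refine HasDerivAt.deriv ?_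
    refine HasDerivAt.fun_sum fun m _ => ?_
    refine HasDerivAt.mul_const ?_ _
    have h : HasDerivAt (fun x' => D.phase m x' y t) (D.k m) x := by
      unfold phase linPhase
      have := (((hasDerivAt_id x).const_mul (D.k m)).add_const (D.k m ^ 2 * y)).add_const
        (D.k m ^ 3 * t) |>.add_const (D.θ₀ m)
      simpa using this
    have := h.exp.const_mul (D.k m ^ j)
    convert this using 1
    ring

theorem exp_phaseSum (S : Finset (Fin M)) (h : S.card = N) (x y t : ℝ) :
    ∏ i, Real.exp (D.phase (S.orderEmbOfFin h i) x y t) = Real.exp (D.phaseSum S x y t) := by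
  rw [← Real.exp_sum, phaseSum]
  conv_rhs => rw [← Finset.map_orderEmbOfFin_univ S h, Finset.sum_map]
  rfl

theorem tau_eq_sum (x y t : ℝ) :
    D.tau x y t = ∑ S, D.setCoeff S * Real.exp (D.phaseSum S x y t) := by
  have h1 : (Matrix.of fun j n : Fin N => iteratedDeriv (j : ℕ) (fun x' => D.f n x' y t) x) =
      (Matrix.of fun (j : Fin N) (m : Fin M) => D.k m ^ (j : ℕ) * Real.exp (D.phase m x y t)) *
        D.A.transpose := by
    ext j n
    simp [iteratedDeriv_f, Matrix.mul_apply]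
  rw [tau, h1, det_mul_eq_sum_minors]
  refine Finset.sum_congr rfl fun S _ => ?_
  unfold setCoeff
  split_ifs with h
  · have h2 : ((Matrix.of fun (j : Fin N) (m : Fin M) =>
        D.k m ^ (j : ℕ) * Real.exp (D.phase m x y t)).submatrix id (S.orderEmbOfFin h)) =
        Matrix.of fun i j => Real.exp (D.phase (S.orderEmbOfFin h j) x y t) *
          (Matrix.of fun j i : Fin N => D.k (S.orderEmbOfFin h i) ^ (j : ℕ)) i j := by
      ext i j
      simp [mul_comm]
    have h3 : (D.A.transpose.submatrix (S.orderEmbOfFin h) id).det =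
        minor D.A (S.orderEmbOfFin h) := by
      rw [minor, ← Matrix.det_transpose]; rfl
    rw [h2, Matrix.det_mul_row, ← vander_eq_det, h3, exp_phaseSum, coeff, vander]
    ring
  · simp

end TauData

end KPII

/-! ### Bases of maximal weight and exchange. -/

namespace KPII

section Bases

open Submodule

variable {N M : ℕ} {v : Fin M → Fin N → ℝ}

/-- The vectors `v m`, `m ∈ S`, form a basis. -/
def IsColBasis (v : Fin M → Fin N → ℝ) (S : Finset (Fin M)) : Prop :=
  S.card = N ∧ LinearIndepOn ℝ v (S : Set (Fin M))

/-- `B` is a basis of maximal total weight. -/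
def IsMaxBasis (v : Fin M → Fin N → ℝ) (w : Fin M → ℝ) (B : Finset (Fin M)) : Prop :=
  IsColBasis v B ∧ ∀ T, IsColBasis v T → ∑ m ∈ T, w m ≤ ∑ m ∈ B, w m

theorem IsColBasis.exchange {B : Finset (Fin M)} (hB : IsColBasis v B) {b x : Fin M} (hb : b ∈ B)
    (hx : v x ∉ span ℝ (v '' ((B : Set (Fin M)) \ {b}))) :
    IsColBasis v (insert x (B.erase b)) := by
  have hxB : x ∉ B.erase b := fun h => hx (subset_span ⟨x, by simpa [and_comm] using h, rfl⟩)
  refine ⟨?_, ?_⟩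
  · rw [Finset.card_insert_of_notMem hxB, Finset.card_erase_of_mem hb, hB.1]
    have : 0 < B.card := Finset.card_pos.2 ⟨b, hb⟩
    have := hB.1
    omega
  · rw [Finset.coe_insert, Finset.coe_erase]
    exact (hB.2.mono Set.sdiff_subset).insert hx

theorem IsColBasis.notMem_span {B : Finset (Fin M)} (hB : IsColBasis v B) {b : Fin M} (hb : b ∈ B)
    {X : Set (Fin M)} (hX : X ⊆ B) (hbX : b ∉ X) : v b ∉ span ℝ (v '' X) := by
  have := (linearIndepOn_insert (K := ℝ) (f := v) hbX).1
    (hB.2.mono (Set.insert_subset hb hX))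
  exact this.2

/-- Lying in the span of `B` without `b` means that the `b`-coordinate vanishes, so the hypothesis
kills every coordinate outside `X`. -/
theorem IsColBasis.mem_span_inter {B : Finset (Fin M)} (hB : IsColBasis v B) (x : Fin N → ℝ)
    (X : Set (Fin M))
    (h : ∀ b ∈ B, b ∉ X → x ∈ span ℝ (v '' ((B : Set (Fin M)) \ {b}))) :
    x ∈ span ℝ (v '' ((B : Set (Fin M)) ∩ X)) := by
  let bs : Module.Basis B ℝ (Fin N → ℝ) := basisOfLinearIndependentOfCardEqFinrank' _ hB.2 (by
    simp [hB.1])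
  have hbs : ∀ b : B, bs b = v b := fun b => by simp [bs]
  have key : ∀ Y : Set (Fin M),
      v '' ((B : Set (Fin M)) ∩ Y) = bs '' {b : B | (b : Fin M) ∈ Y} := by
    intro Y
    ext z
    constructor
    · rintro ⟨m, ⟨hm, hmY⟩, rfl⟩
      exact ⟨⟨m, hm⟩, hmY, hbs _⟩
    · rintro ⟨b, hbY, rfl⟩
      exact ⟨b, ⟨b.2, hbY⟩, (hbs b).symm⟩
  rw [key, Module.Basis.mem_span_image]
  intro b hb
  by_contra hbX
  have := h b b.2 hbX
  rw [Set.sdiff_eq, key, Module.Basis.mem_span_image] at this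
  exact this hb rfl

theorem sum_insert_erase {w : Fin M → ℝ} {B : Finset (Fin M)} {b x : Fin M} (hb : b ∈ B)
    (hx : x ∉ B.erase b) :
    ∑ m ∈ insert x (B.erase b), w m = ∑ m ∈ B, w m + w x - w b := by
  rw [Finset.sum_insert hx, ← Finset.add_sum_erase B w hb]
  ring

/-- The greedy property: if `v x` had a nonzero coordinate at some `b ∈ B` outside `X`, replacing
`b` by the heavier `x` would increase the weight. -/
theorem IsMaxBasis.mem_span {w : Fin M → ℝ} {B : Finset (Fin M)} (hB : IsMaxBasis v w B)
    {X : Set (Fin M)} (hX : ∀ x ∈ X, ∀ y ∉ X, w y < w x) {x : Fin M} (hx : x ∈ X) :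
    v x ∈ span ℝ (v '' ((B : Set (Fin M)) ∩ X)) := by
  refine hB.1.mem_span_inter _ _ fun b hb hbX => ?_
  by_contra h
  have hxB : x ∉ B.erase b := fun h' => h (subset_span ⟨x, by simpa [and_comm] using h', rfl⟩)
  have := hB.2 _ (hB.1.exchange hb h)
  rw [sum_insert_erase hb hxB] at this
  have := hX x hx b hbX
  linarith

/-- If no `j` worked, every vector of `B₂` occurring in `v i` would lie in the span of `B₁` without
`i`, hence so would `v i`. -/
theorem IsColBasis.exists_symm_exchange {B₁ B₂ : Finset (Fin M)} (h₁ : IsColBasis v B₁)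
    (h₂ : IsColBasis v B₂) {i : Fin M} (hi : i ∈ B₁) (hi₂ : i ∉ B₂) :
    ∃ j ∈ B₂, j ∉ B₁ ∧ IsColBasis v (insert j (B₁.erase i)) ∧
      IsColBasis v (insert i (B₂.erase j)) := by
  obtain ⟨j, hj, hj1, hj2⟩ : ∃ j ∈ B₂, v j ∉ span ℝ (v '' ((B₁ : Set (Fin M)) \ {i})) ∧
      v i ∉ span ℝ (v '' ((B₂ : Set (Fin M)) \ {j})) := by
    by_contra! hcon
    have h := h₂.mem_span_inter (v i) {j | v j ∈ span ℝ (v '' ((B₁ : Set (Fin M)) \ {i}))} hcon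
    refine h₁.notMem_span hi (X := (B₁ : Set (Fin M)) \ {i}) Set.sdiff_subset (by simp) ?_
    refine (span_le.2 ?_ : span ℝ _ ≤ _) h
    rintro _ ⟨m, hm, rfl⟩
    exact hm.2
  have hjB : j ∉ B₁ := fun h => hj1 (subset_span ⟨j, ⟨h, fun h' => by
    simp only [Set.mem_singleton_iff] at h'
    exact hi₂ (h' ▸ hj)⟩, rfl⟩)
  exact ⟨j, hj, hjB, h₁.exchange hi hj1, h₂.exchange hj hj2⟩

/-- Symmetric exchange changes the two weights by opposite amounts; neither can increase, so both
stay maximal. -/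
theorem IsMaxBasis.exists_exchange {w : Fin M → ℝ} {B₁ B₂ : Finset (Fin M)}
    (h₁ : IsMaxBasis v w B₁) (h₂ : IsMaxBasis v w B₂) {i : Fin M} (hi : i ∈ B₁) (hi₂ : i ∉ B₂) :
    ∃ j ∈ B₂, j ∉ B₁ ∧ w i = w j ∧ IsMaxBasis v w (insert j (B₁.erase i)) := by
  obtain ⟨j, hj, hj₁, hb₁, hb₂⟩ := h₁.1.exists_symm_exchange h₂.1 hi hi₂
  have e₁ := sum_insert_erase (w := w) hi (x := j) (by simp [hj₁])
  have e₂ := sum_insert_erase (w := w) hj (x := i) (by simp [hi₂])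
  have l₁ := h₁.2 _ hb₁
  have l₂ := h₂.2 _ hb₂
  refine ⟨j, hj, hj₁, by linarith, hb₁, fun T hT => ?_⟩
  have := h₁.2 T hT
  linarith

theorem exists_isMaxBasis (w : Fin M → ℝ) {B : Finset (Fin M)} (hB : IsColBasis v B) :
    ∃ B, IsMaxBasis v w B := by
  classical
  obtain ⟨B', hB', h⟩ := Finset.exists_max_image
    (Finset.univ.filter fun S : Finset (Fin M) => IsColBasis v S) (fun S => ∑ m ∈ S, w m)
    ⟨B, by simpa using hB⟩
  simp only [Finset.mem_filter, Finset.mem_univ, true_and] at hB' h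
  exact ⟨B', hB', h⟩

/-- Bases of maximal weight which differ by exchanging `i` and `j` exist if and only if `v i` and
`v j` are parallel and nonzero modulo the span of the vectors of larger weight. -/
theorem exists_isMaxBasis_insert_iff {w : Fin M → ℝ} {B : Finset (Fin M)} (hB : IsColBasis v B)
    {i j : Fin M} (hij : i ≠ j) {X : Set (Fin M)} (hiX : i ∉ X) (hjX : j ∉ X)
    (hw : w i = w j) (hX : ∀ m ∈ X, w i < w m) (hXc : ∀ m ∉ X, m ≠ i → m ≠ j → w m < w i) :
    (∃ S, i ∉ S ∧ j ∉ S ∧ IsMaxBasis v w (insert i S) ∧ IsMaxBasis v w (insert j S)) ↔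
      v i ∉ span ℝ (v '' X) ∧ v i ∈ span ℝ (v '' insert j X) := by
  have hXu : ∀ x ∈ X, ∀ y ∉ X, w y < w x := by
    intro x hx y hy
    refine lt_of_le_of_lt ?_ (hX x hx)
    by_cases h1 : y = i
    · rw [h1]
    by_cases h2 : y = j
    · rw [h2, hw]
    exact (hXc y hy h1 h2).le
  have hXu' : ∀ x ∈ insert i (insert j X), ∀ y ∉ insert i (insert j X), w y < w x := by
    intro x hx y hy
    simp only [Set.mem_insert_iff, not_or] at hx hy
    refine lt_of_lt_of_le (hXc y hy.2.2 hy.1 hy.2.1) ?_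
    rcases hx with rfl | rfl | hx
    · exact le_rfl
    · exact hw.le
    · exact (hX x hx).le
  constructor
  · rintro ⟨S, hi, hj, hSi, hSj⟩
    have e1 : ((insert i S : Finset (Fin M)) : Set (Fin M)) ∩ X = (S : Set (Fin M)) ∩ X := by
      ext m
      simp only [Finset.coe_insert, Set.mem_inter_iff, Set.mem_insert_iff, Finset.mem_coe]
      constructor
      · rintro ⟨rfl | h, h'⟩
        · exact absurd h' hiX
        · exact ⟨h, h'⟩
      · rintro ⟨h, h'⟩; exact ⟨.inr h, h'⟩
    refine ⟨fun h => ?_, ?_⟩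
    · have h1 : span ℝ (v '' X) ≤ span ℝ (v '' ((S : Set (Fin M)) ∩ X)) := by
        rw [span_le]
        rintro _ ⟨m, hm, rfl⟩
        rw [← e1]
        exact hSi.mem_span hXu hm
      refine hSi.1.notMem_span (Finset.mem_insert_self i S) (X := (S : Set (Fin M)) ∩ X) ?_ ?_ (h1 h)
      · intro m hm
        simp [hm.1]
      · simp [hi]
    · refine span_mono (Set.image_mono ?_) (hSj.mem_span hXu' (Set.mem_insert i _))
      rintro m ⟨hm, hm'⟩
      rcases hm' with rfl | h
      · simp only [Finset.coe_insert, Set.mem_insert_iff, Finset.mem_coe] at hm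
        rcases hm with h | h
        · exact absurd h hij
        · exact absurd h hi
      · exact h
  · rintro ⟨h1, h2⟩
    -- Any maximal basis contains exactly one of `i`, `j`: both would contradict independence, and
    -- neither would put `v i` in the span of `X`. Swapping the one for the other gives the second
    -- basis.
    obtain ⟨B, hB⟩ := exists_isMaxBasis w hB
    have hsub : ∀ {Y Z : Set (Fin M)} {x : Fin N → ℝ}, (∀ m ∈ Y, v m ∈ span ℝ (v '' Z)) →
        x ∈ span ℝ (v '' Y) → x ∈ span ℝ (v '' Z) := by
      intro Y Z x h hx
      refine (span_le.2 ?_ : span ℝ _ ≤ _) hx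
      rintro _ ⟨m, hm, rfl⟩
      exact h m hm
    have hXB : ∀ m ∈ X, v m ∈ span ℝ (v '' ((B : Set (Fin M)) ∩ X)) := fun m hm =>
      hB.mem_span hXu hm
    have hXj : v i ∈ span ℝ (v '' insert j ((B : Set (Fin M)) ∩ X)) := by
      refine hsub ?_ h2
      rintro m (rfl | hm)
      · exact subset_span ⟨m, by simp, rfl⟩
      · exact span_mono (Set.image_mono (Set.subset_insert _ _)) (hXB m hm)
    have hnot : ¬ (i ∈ B ∧ j ∈ B) := by
      rintro ⟨hi, hj⟩
      refine hB.1.notMem_span hi ?_ ?_ hXj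
      · exact Set.insert_subset hj Set.inter_subset_left
      · simp [hij, hiX]
    have hiff : ∀ {a b : Fin M}, a ∈ B → b ∉ B → w a = w b → a ≠ b →
        v b ∉ span ℝ (v '' ((B : Set (Fin M)) \ {a})) →
        ∃ S, b ∉ S ∧ a ∉ S ∧ IsMaxBasis v w (insert b S) ∧ IsMaxBasis v w (insert a S) := by
      intro a b ha hb hab hne hspan
      refine ⟨B.erase a, by simp [hb], by simp, ⟨hB.1.exchange ha hspan, fun T hT => ?_⟩, ?_⟩
      · rw [sum_insert_erase ha (by simp [hb]), hab]
        have := hB.2 T hT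
        linarith
      · rwa [Finset.insert_erase ha]
    have hred : ∀ {a b : Fin M}, a ∉ X → v b ∈ span ℝ (v '' insert a ((B : Set (Fin M)) ∩ X)) →
        b ∉ B → a ∈ B → v b ∈ span ℝ (v '' ((B : Set (Fin M)) \ {a})) →
        v b ∈ span ℝ (v '' X) := by
      intro a b haX hb hbB haB h
      have : v b ∈ span ℝ (v '' ((B : Set (Fin M)) ∩ X)) := by
        refine hB.1.mem_span_inter _ _ fun c hc hcX => ?_
        by_cases hca : c = a
        · rw [hca]; exact h
        · refine span_mono (Set.image_mono ?_) hb
          rintro m (rfl | hm)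
          · exact ⟨haB, fun h => hca h.symm⟩
          · exact ⟨hm.1, fun h => hcX (h ▸ hm.2)⟩
      exact span_mono (Set.image_mono Set.inter_subset_right) this
    by_cases hj : j ∈ B
    · have hi : i ∉ B := fun hi => hnot ⟨hi, hj⟩
      exact hiff hj hi hw.symm hij.symm fun h => h1 (hred hjX hXj hi hj h)
    · have hi : i ∈ B := by
        by_contra hi
        refine h1 (span_mono (Set.image_mono ?_) (hB.mem_span hXu' (Set.mem_insert i _)))
        rintro m ⟨hm, rfl | rfl | h⟩
        · exact absurd hm hi
        · exact absurd hm hj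
        · exact h
      have hvj : v j ∈ span ℝ (v '' insert i ((B : Set (Fin M)) ∩ X)) := by
        refine span_mono (Set.image_mono ?_)
          (hB.mem_span hXu' (x := j) (by simp))
        rintro m ⟨hm, rfl | rfl | h⟩
        · simp
        · exact absurd hm hj
        · exact .inr ⟨hm, h⟩
      obtain ⟨S, s1, s2, s3, s4⟩ := hiff hi hj hw hij fun h => by
        have h3 := hred hiX hvj hj hi h
        refine h1 (hsub ?_ h2)
        rintro m (rfl | hm)
        · exact h3
        · exact subset_span ⟨m, hm, rfl⟩
      exact ⟨S, s2, s1, s4, s3⟩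

end Bases

end KPII

/-! ### Reduced echelon form and irreducibility in terms of bases. -/

namespace KPII

open Submodule

section Echelon

variable {N M : ℕ} {A : Matrix (Fin N) (Fin M) ℝ}

/-- The columns of a matrix. -/
def cols (A : Matrix (Fin N) (Fin M) ℝ) : Fin M → Fin N → ℝ := fun m n => A n m

theorem minor_ne_zero_iff (m : Fin N ↪o Fin M) :
    minor A m ≠ 0 ↔ IsColBasis (cols A) (Finset.univ.map m.toEmbedding) := by
  rw [minor, ← isUnit_iff_ne_zero, ← Matrix.isUnit_iff_isUnit_det,
    ← Matrix.linearIndependent_cols_iff_isUnit]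
  unfold IsColBasis
  have : ((Finset.univ.map m.toEmbedding : Finset (Fin M)) : Set (Fin M)) = Set.range m := by
    simp
  rw [this, linearIndepOn_range_iff m.injective]
  simp only [Finset.card_map, Finset.card_univ, Fintype.card_fin, true_and]
  rfl

theorem IsColBasis.mem_span_image {v : Fin M → Fin N → ℝ} {B : Finset (Fin M)}
    (hB : IsColBasis v B) (x : Fin N → ℝ) : x ∈ span ℝ (v '' (B : Set (Fin M))) := by
  simpa using hB.mem_span_inter x Set.univ (by simp)

theorem exists_isLeading {n : Fin N} (h : ∃ m, A n m ≠ 0) : ∃ m, IsLeading A n m := by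
  classical
  obtain ⟨m₀, hm₀⟩ := h
  obtain ⟨m, hm, hmin⟩ := Finset.exists_min_image (Finset.univ.filter fun m => A n m ≠ 0) id
    ⟨m₀, by simpa using hm₀⟩
  simp only [Finset.mem_filter, Finset.mem_univ, true_and, id] at hm hmin
  refine ⟨m, hm, fun m' hm' => ?_⟩
  by_contra hne
  exact absurd (hmin m' hne) (not_le.2 hm')

theorem exists_ne_zero_of_rank (h : A.rank = N) (n : Fin N) : ∃ m, A n m ≠ 0 := by
  by_contra! hn
  have hli : LinearIndependent ℝ A.row := by
    rw [linearIndependent_iff_card_eq_finrank_span, Set.finrank, ← Matrix.rank_eq_finrank_span_row,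
      h, Fintype.card_fin]
  exact hli.ne_zero n (funext hn)

theorem exists_pivots (h : A.rank = N) (hA : IsRREF A) :
    ∃ e : Fin N → Fin M, StrictMono e ∧ (∀ n, IsLeading A n (e n)) ∧
      Set.range e = {m | IsPivot A m} := by
  choose e he using fun n => exists_isLeading (exists_ne_zero_of_rank h n)
  refine ⟨e, fun n n' hn => hA.staircase n n' _ _ hn (he n) (he n'), he, ?_⟩
  ext m
  constructor
  · rintro ⟨n, rfl⟩; exact ⟨n, he n⟩
  · rintro ⟨n, hn⟩
    refine ⟨n, le_antisymm ?_ ?_⟩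
    · by_contra hlt
      exact hn.1 ((he n).2 m (not_le.1 hlt))
    · by_contra hlt
      exact (he n).1 (hn.2 _ (not_le.1 hlt))

theorem apply_pivot (hA : IsRREF A) {e : Fin N → Fin M} (he : ∀ n, IsLeading A n (e n))
    (n n' : Fin N) : A n (e n') = if n = n' then 1 else 0 := by
  split_ifs with h
  · subst h; exact hA.leading_eq_one _ _ (he n)
  · exact hA.zero_off_pivot _ _ (he n') _ h

theorem isColBasis_pivots (hA : IsRREF A) {e : Fin N → Fin M} (hmono : StrictMono e)
    (he : ∀ n, IsLeading A n (e n)) :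
    IsColBasis (cols A) (Finset.univ.map (OrderEmbedding.ofStrictMono e hmono).toEmbedding) := by
  rw [← minor_ne_zero_iff, minor]
  have : A.submatrix id (OrderEmbedding.ofStrictMono e hmono) = 1 := by
    ext n n'
    simp [apply_pivot hA he, Matrix.one_apply]
  rw [this, Matrix.det_one]
  exact one_ne_zero

theorem notMem_span_of_row {n : Fin N} {m : Fin M} {X : Set (Fin M)} (hm : A n m ≠ 0)
    (hX : ∀ m' ∈ X, A n m' = 0) : (cols A) m ∉ span ℝ ((cols A) '' X) := by
  intro h
  have : span ℝ ((cols A) '' X) ≤ LinearMap.ker (LinearMap.proj n : (Fin N → ℝ) →ₗ[ℝ] ℝ) := by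
    rw [span_le]
    rintro _ ⟨m', hm', rfl⟩
    exact hX m' hm'
  exact hm (this h)

/-- Column `m` is the combination of the pivot columns `e n` with coefficients `A n m`, and these
vanish when `m < e n`. The span criterion links pivots to the weight order. -/
theorem isPivot_iff (h : A.rank = N) (hA : IsRREF A) (m : Fin M) :
    IsPivot A m ↔ (cols A) m ∉ span ℝ ((cols A) '' Set.Iio m) := by
  constructor
  · rintro ⟨n, hn⟩
    exact notMem_span_of_row hn.1 hn.2
  · intro hm
    by_contra hp
    obtain ⟨e, -, he, -⟩ := exists_pivots h hA
    refine hm ?_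
    have : (cols A) m = ∑ n, A n m • (cols A) (e n) := by
      ext n
      simp [cols, apply_pivot hA he, Finset.sum_apply]
    rw [this]
    refine Submodule.sum_mem _ fun n _ => ?_
    by_cases hn : A n m = 0
    · simp [hn]
    · refine Submodule.smul_mem _ _ (subset_span ⟨e n, ?_, rfl⟩)
      refine lt_of_not_ge fun hle : m ≤ e n => ?_
      rcases hle.lt_or_eq with hlt | heq
      · exact hn ((he n).2 m hlt)
      · exact hp ⟨n, heq ▸ he n⟩

/-- No loops and no coloops: each basis needed is the pivot basis or one exchange away from it. -/
theorem exists_isColBasis_mem (h : A.rank = N) (hA : IsRREF A) (hi : IsIrreducible A)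
    (m : Fin M) : (∃ B, IsColBasis (cols A) B ∧ m ∈ B) ∧
      ∃ B, IsColBasis (cols A) B ∧ m ∉ B := by
  obtain ⟨e, hmono, he, -⟩ := exists_pivots h hA
  have hP := isColBasis_pivots hA hmono he
  set P := Finset.univ.map (OrderEmbedding.ofStrictMono e hmono).toEmbedding with hPdef
  have hmem : ∀ {m}, m ∈ P ↔ ∃ n, e n = m := by simp [hPdef]
  have hswap : ∀ n m', A n m' ≠ 0 → IsColBasis (cols A) (insert m' (P.erase (e n))) := by
    intro n m' hn
    refine hP.exchange (hmem.2 ⟨n, rfl⟩) (notMem_span_of_row hn ?_)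
    rintro x ⟨hx, hne⟩
    obtain ⟨n', rfl⟩ := hmem.1 hx
    rw [apply_pivot hA he, if_neg]
    intro hnn
    subst hnn
    exact hne rfl
  constructor
  · obtain ⟨n, hn⟩ := hi.col m
    exact ⟨_, hswap n m hn, Finset.mem_insert_self _ _⟩
  · by_cases hm : m ∈ P
    · obtain ⟨n, rfl⟩ := hmem.1 hm
      obtain ⟨m', hm', hl⟩ := hi.row n
      refine ⟨_, hswap n m' hm', ?_⟩
      simp only [Finset.mem_insert, Finset.mem_erase, ne_eq, not_true_eq_false, false_and,
        or_false]
      rintro rfl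
      exact hl (he n)
    · exact ⟨P, hP, hm⟩

end Echelon

/-! ### Elasticity as closure under complements, and dominance as maximal weight. -/

namespace TauData

variable {N M : ℕ} {D : TauData N M}

theorem mem_phaseSet_iff_isColBasis (hk : StrictMono D.k) {S : Finset (Fin M)} :
    S ∈ D.phaseSet ↔ IsColBasis (cols D.A) S := by
  have hc : ∀ m : Fin N ↪o Fin M, D.coeff m ≠ 0 ↔ minor D.A m ≠ 0 := fun m =>
    mul_ne_zero_iff_right (vander_pos hk m.strictMono).ne'
  constructor
  · rintro ⟨m, hm, rfl⟩
    exact (minor_ne_zero_iff m).1 ((hc m).1 hm)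
  · intro h
    have hS := Finset.map_orderEmbOfFin_univ S h.1
    refine ⟨S.orderEmbOfFin h.1, (hc _).2 ((minor_ne_zero_iff _).2 ?_), hS⟩
    rwa [hS]

theorem exponent_injective : Function.Injective (exponent (M := M)) := by
  intro S T h
  ext m
  have := congrFun h m
  simp only [exponent] at this
  by_cases h1 : m ∈ S <;> by_cases h2 : m ∈ T <;> simp_all

/-- Each index lies in some basis and outside another, so adding `c m` must send both 0 and 1 into
{0, 1}; hence `c = 0`. -/
theorem isElastic_iff_image (hD : D.Admissible) :
    D.IsElastic ↔ (fun S => Sᶜ) '' D.phaseSet = D.phaseSet := by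
  constructor
  · rintro ⟨-, c, hc⟩
    have hmem : ∀ S, IsColBasis (cols D.A) S → ∃ T, exponent Sᶜ + c = exponent T := by
      intro S hS
      have : exponent Sᶜ + c ∈ exponent '' D.phaseSet := by
        rw [← hc]
        exact ⟨_, ⟨S, (mem_phaseSet_iff_isColBasis hD.strictMono).2 hS, rfl⟩, rfl⟩
      obtain ⟨T, -, hT⟩ := this
      exact ⟨T, hT.symm⟩
    have h01 : ∀ (T : Finset (Fin M)) m, exponent T m = 0 ∨ exponent T m = 1 := by
      intro T m
      unfold exponent
      split_ifs <;> simp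
    have hc0 : c = 0 := by
      ext m
      obtain ⟨⟨B₁, h₁, m₁⟩, ⟨B₂, h₂, m₂⟩⟩ :=
        exists_isColBasis_mem hD.rank hD.rref hD.irreducible m
      obtain ⟨T₁, e₁⟩ := hmem B₁ h₁
      obtain ⟨T₂, e₂⟩ := hmem B₂ h₂
      have e₁ := congrFun e₁ m
      have e₂ := congrFun e₂ m
      simp only [Pi.add_apply, exponent, Finset.mem_compl, m₁, m₂, not_true_eq_false,
        not_false_eq_true, if_true, if_false] at e₁ e₂
      have l₁ := h01 T₁ m
      have l₂ := h01 T₂ m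
      unfold exponent at l₁ l₂
      rw [← e₁] at l₁
      rw [← e₂] at l₂
      simp only [Pi.zero_apply]
      rcases l₁ with l₁ | l₁ <;> rcases l₂ with l₂ | l₂ <;> linarith
    subst hc0
    have : (fun S : Finset (Fin M) => exponent S + 0) = exponent := by simp
    rw [this] at hc
    exact exponent_injective.image_injective hc
  · intro h
    refine ⟨rfl, 0, ?_⟩
    rw [h]
    simp

theorem isElastic_iff_compl (hD : D.Admissible) :
    D.IsElastic ↔ ∀ S, IsColBasis (cols D.A) S → IsColBasis (cols D.A) Sᶜ := by
  rw [isElastic_iff_image hD]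
  simp only [← mem_phaseSet_iff_isColBasis hD.strictMono]
  constructor
  · intro h S hS
    rw [← h]
    exact ⟨S, hS, rfl⟩
  · intro h
    ext S
    constructor
    · rintro ⟨T, hT, rfl⟩; exact h T hT
    · intro hS; exact ⟨Sᶜ, h S hS, compl_compl S⟩

theorem exists_isColBasis (hD : D.Admissible) : ∃ B, IsColBasis (cols D.A) B := by
  obtain ⟨e, hmono, he, -⟩ := exists_pivots hD.rank hD.rref
  exact ⟨_, isColBasis_pivots hD.rref hmono he⟩

theorem IsElastic.eq_two_mul (hD : D.Admissible) (h : D.IsElastic) : M = 2 * N := by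
  rw [isElastic_iff_compl hD] at h
  obtain ⟨B, hB⟩ := exists_isColBasis hD
  have h1 := (h B hB).1
  have h2 := Finset.card_add_card_compl B
  rw [hB.1, h1, Fintype.card_fin] at h2
  omega

theorem map_univ_compl {m l : Fin N ↪o Fin M} (h : IsCompl (Set.range m) (Set.range l)) :
    (Finset.univ.map m.toEmbedding)ᶜ = Finset.univ.map l.toEmbedding := by
  rw [← Finset.coe_inj]
  simp only [Finset.coe_compl, Finset.coe_map, Finset.coe_univ, Set.image_univ,
    RelEmbedding.coe_toEmbedding]
  exact h.compl_eq

theorem isElastic_iff (hD : D.Admissible) :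
    D.IsElastic ↔ M = 2 * N ∧ MinorDuality D.A := by
  constructor
  · intro h
    refine ⟨h.eq_two_mul hD, fun m l hml => ?_⟩
    rw [isElastic_iff_compl hD] at h
    rw [← not_iff_not]
    change minor D.A m ≠ 0 ↔ minor D.A l ≠ 0
    rw [minor_ne_zero_iff, minor_ne_zero_iff, ← map_univ_compl hml]
    refine ⟨h _, fun h' => ?_⟩
    simpa using h _ h'
  · rintro ⟨hM, h⟩
    rw [isElastic_iff_compl hD]
    intro S hS
    have hc : Sᶜ.card = N := by
      rw [Finset.card_compl, hS.1, Fintype.card_fin]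
      omega
    have hml : IsCompl (Set.range (S.orderEmbOfFin hS.1)) (Set.range (Sᶜ.orderEmbOfFin hc)) := by
      rw [Finset.range_orderEmbOfFin, Finset.range_orderEmbOfFin, Finset.coe_compl]
      exact isCompl_compl
    have := not_iff_not.2 (h _ _ hml)
    change minor D.A _ ≠ 0 ↔ minor D.A _ ≠ 0 at this
    rw [minor_ne_zero_iff, minor_ne_zero_iff, Finset.map_orderEmbOfFin_univ,
      Finset.map_orderEmbOfFin_univ] at this
    exact this.1 hS

/-- The growth rate in `y` of the phase `m` along the lines `x + c y = ξ`, with sign `σ`. -/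
def weight (D : TauData N M) (σ c : ℝ) (m : Fin M) : ℝ := σ * (D.k m ^ 2 - c * D.k m)

theorem weight_sub (σ : ℝ) (i j m : Fin M) :
    D.weight σ (D.k i + D.k j) m - D.weight σ (D.k i + D.k j) i =
      σ * ((D.k m - D.k i) * (D.k m - D.k j)) := by
  unfold weight; ring

theorem weight_left_eq_right (σ : ℝ) (i j : Fin M) :
    D.weight σ (D.k i + D.k j) i = D.weight σ (D.k i + D.k j) j := by
  unfold weight; ring

/-- The part of the phase `m` which does not grow along the lines `x + c y = ξ`. -/
def offset (D : TauData N M) (ξ t : ℝ) (m : Fin M) : ℝ := D.k m * ξ + D.k m ^ 3 * t + D.θ₀ m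

theorem phaseSum_line {σ : ℝ} (hσ : σ * σ = 1) (S : Finset (Fin M)) (c ξ y t : ℝ) :
    D.phaseSum S (ξ - c * y) y t =
      (∑ m ∈ S, D.weight σ c m) * (σ * y) + ∑ m ∈ S, D.offset ξ t m := by
  rw [phaseSum, Finset.sum_mul, ← Finset.sum_add_distrib]
  refine Finset.sum_congr rfl fun m _ => ?_
  unfold phase linPhase weight offset
  linear_combination (-(D.k m ^ 2 - c * D.k m) * y) * hσ

theorem phase_eq_iff {i j : Fin M} (hij : D.k i ≠ D.k j) (x y t : ℝ) :
    D.phase i x y t = D.phase j x y t ↔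
      x = -((D.k j ^ 3 - D.k i ^ 3) * t + D.θ₀ j - D.θ₀ i) / (D.k j - D.k i) -
        (D.k i + D.k j) * y := by
  have : D.k j - D.k i ≠ 0 := sub_ne_zero.2 hij.symm
  rw [eq_sub_iff_add_eq, eq_div_iff this]
  unfold phase linPhase
  constructor <;> intro h <;> linear_combination -h

/-- At fixed `t`, the line `θ i = θ j` is one of the lines `x + c y = ξ`, where a phase combination
is its weight times `σ y` plus a constant. Bounded excess therefore compares the weights alone. The
sign `σ` treats both ends at once. -/
theorem isTransition_iff (hk : StrictMono D.k) {l : Filter ℝ} [l.NeBot] {σ : ℝ} (hσ : σ * σ = 1)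
    (hl : Tendsto (fun y => σ * y) l atTop) (i j : Fin M) :
    D.IsTransition l i j ↔ i < j ∧ ∃ S, i ∉ S ∧ j ∉ S ∧
      IsMaxBasis (cols D.A) (D.weight σ (D.k i + D.k j)) (insert i S) ∧
      IsMaxBasis (cols D.A) (D.weight σ (D.k i + D.k j)) (insert j S) := by
  refine and_congr_right fun hij => exists_congr fun S => and_congr_right fun hi =>
    and_congr_right fun hj => ?_
  simp only [mem_phaseSet_iff_isColBasis hk]
  have hw : ∑ m ∈ insert j S, D.weight σ (D.k i + D.k j) m =
      ∑ m ∈ insert i S, D.weight σ (D.k i + D.k j) m := by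
    rw [Finset.sum_insert hi, Finset.sum_insert hj, weight_left_eq_right]
  simp only [phase_eq_iff (hk hij).ne, forall_eq]
  unfold IsMaxBasis
  rw [hw]
  simp only [phaseSum_line hσ]
  constructor
  · rintro ⟨h1, h2, h⟩
    suffices H : ∀ T, IsColBasis (cols D.A) T → ∑ m ∈ T, D.weight σ (D.k i + D.k j) m ≤
        ∑ m ∈ insert i S, D.weight σ (D.k i + D.k j) m from ⟨⟨h1, H⟩, h2, H⟩
    intro T hT
    obtain ⟨C, hC⟩ := h T hT 0
    by_contra! hlt
    have hlim : Tendsto (fun y => (∑ m ∈ T, D.weight σ (D.k i + D.k j) m -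
        ∑ m ∈ insert i S, D.weight σ (D.k i + D.k j) m) * (σ * y)) l atTop :=
      hl.const_mul_atTop (sub_pos.2 hlt)
    obtain ⟨y, hy1, hy2⟩ := (hC.and (hlim.eventually_gt_atTop (C + ∑ m ∈ insert i S, D.offset
      (-((D.k j ^ 3 - D.k i ^ 3) * 0 + D.θ₀ j - D.θ₀ i) / (D.k j - D.k i)) 0 m -
      ∑ m ∈ T, D.offset
      (-((D.k j ^ 3 - D.k i ^ 3) * 0 + D.θ₀ j - D.θ₀ i) / (D.k j - D.k i)) 0 m))).exists
    linarith
  · rintro ⟨⟨h1, h⟩, h2, -⟩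
    refine ⟨h1, h2, fun T hT t => ⟨∑ m ∈ T, D.offset
      (-((D.k j ^ 3 - D.k i ^ 3) * t + D.θ₀ j - D.θ₀ i) / (D.k j - D.k i)) t m -
      ∑ m ∈ insert i S, D.offset
      (-((D.k j ^ 3 - D.k i ^ 3) * t + D.θ₀ j - D.θ₀ i) / (D.k j - D.k i)) t m, ?_⟩⟩
    filter_upwards [hl.eventually_ge_atTop 0] with y hy
    have := mul_le_mul_of_nonneg_right (h T hT) hy
    linarith

theorem tendsto_one_mul_atTop : Tendsto (fun y : ℝ => 1 * y) atTop atTop := by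
  simp only [one_mul]
  exact tendsto_id

theorem tendsto_neg_one_mul_atBot : Tendsto (fun y : ℝ => -1 * y) atBot atTop := by
  simpa using tendsto_neg_atBot_atTop

/-- By `weight_sub` the sign of `(k m - k i) * (k m - k j)` decides: the heavier columns are those
outside the interval. -/
theorem isTransition_atTop_iff (hD : D.Admissible) (i j : Fin M) :
    D.IsTransition atTop i j ↔ i < j ∧
      (cols D.A) i ∉ span ℝ ((cols D.A) '' {m | m < i ∨ j < m}) ∧
      (cols D.A) i ∈ span ℝ ((cols D.A) '' {m | m < i ∨ j ≤ m}) := by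
  rw [isTransition_iff hD.strictMono (by norm_num) tendsto_one_mul_atTop]
  refine and_congr_right fun hij => ?_
  obtain ⟨B, hB⟩ := exists_isColBasis hD
  have hX : {m | m < i ∨ j ≤ m} = insert j {m | m < i ∨ j < m} := by
    ext m
    simp only [Set.mem_ofPred_eq, Set.mem_insert_iff, le_iff_lt_or_eq, eq_comm (a := j)]
    tauto
  rw [hX]
  refine exists_isMaxBasis_insert_iff hB hij.ne (by simp [hij.le]) (by simp [hij.le])
    (weight_left_eq_right 1 i j) ?_ ?_
  · intro m hm
    rw [← sub_pos, weight_sub, one_mul]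
    rcases hm with hm | hm
    · exact mul_pos_of_neg_of_neg (sub_neg.2 (hD.strictMono hm))
        (sub_neg.2 (hD.strictMono (hm.trans hij)))
    · exact mul_pos (sub_pos.2 (hD.strictMono (hij.trans hm))) (sub_pos.2 (hD.strictMono hm))
  · intro m hm hmi hmj
    simp only [Set.mem_ofPred_eq, not_or, not_lt] at hm
    rw [← sub_neg, weight_sub, one_mul]
    exact mul_neg_of_pos_of_neg (sub_pos.2 (hD.strictMono (lt_of_le_of_ne hm.1 (Ne.symm hmi))))
      (sub_neg.2 (hD.strictMono (lt_of_le_of_ne hm.2 hmj)))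

/-- The sign is reversed, so the heavier columns are those strictly between `i` and `j`. -/
theorem isTransition_atBot_iff (hD : D.Admissible) (i j : Fin M) :
    D.IsTransition atBot i j ↔ i < j ∧
      (cols D.A) j ∉ span ℝ ((cols D.A) '' Set.Ioo i j) ∧
      (cols D.A) j ∈ span ℝ ((cols D.A) '' Set.Ico i j) := by
  rw [isTransition_iff hD.strictMono (by norm_num) tendsto_neg_one_mul_atBot]
  refine and_congr_right fun hij => ?_
  obtain ⟨B, hB⟩ := exists_isColBasis hD
  rw [← Set.Ioo_insert_left hij]
  rw [← exists_isMaxBasis_insert_iff hB hij.ne' (w := D.weight (-1) (D.k i + D.k j)) (by simp)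
    (by simp) (weight_left_eq_right (-1) i j).symm]
  · refine exists_congr fun S => ?_
    tauto
  · intro m hm
    rw [← weight_left_eq_right, ← sub_pos, weight_sub]
    have := mul_pos (sub_pos.2 (hD.strictMono hm.1)) (sub_pos.2 (hD.strictMono hm.2))
    linarith
  · intro m hm hmj hmi
    rw [← weight_left_eq_right, ← sub_neg, weight_sub]
    rcases lt_or_gt_of_ne hmi with h | h
    · have := mul_pos_of_neg_of_neg (sub_neg.2 (hD.strictMono h))
        (sub_neg.2 (hD.strictMono (h.trans hij)))
      linarith
    · have hmj' : j < m := lt_of_le_of_ne (not_lt.1 fun h' => hm ⟨h, h'⟩) (Ne.symm hmj)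
      have := mul_pos (sub_pos.2 (hD.strictMono h)) (sub_pos.2 (hD.strictMono hmj'))
      linarith

/-- The weights of a set and its complement have a fixed sum, so maximizing one minimizes the other.
-/
theorem IsElastic.isMaxBasis_compl (hD : D.Admissible) (h : D.IsElastic) {σ c : ℝ}
    {B : Finset (Fin M)} (hB : IsMaxBasis (cols D.A) (D.weight σ c) B) :
    IsMaxBasis (cols D.A) (D.weight (-σ) c) Bᶜ := by
  rw [isElastic_iff_compl hD] at h
  refine ⟨h B hB.1, fun T hT => ?_⟩
  have h1 := hB.2 _ (h T hT)
  have h2 := Finset.sum_add_sum_compl T (D.weight σ c)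
  have h3 := Finset.sum_add_sum_compl B (D.weight σ c)
  have h4 : ∀ S : Finset (Fin M), ∑ m ∈ S, D.weight (-σ) c m = -∑ m ∈ S, D.weight σ c m := by
    intro S
    rw [← Finset.sum_neg_distrib]
    exact Finset.sum_congr rfl fun m _ => by unfold weight; ring
  rw [h4, h4]
  linarith

theorem IsElastic.isTransition_neg (hD : D.Admissible) (h : D.IsElastic) {l l' : Filter ℝ}
    [l.NeBot] [l'.NeBot] {σ : ℝ} (hσ : σ * σ = 1) (hl : Tendsto (fun y => σ * y) l atTop)
    (hl' : Tendsto (fun y => -σ * y) l' atTop) {i j : Fin M} (ht : D.IsTransition l i j) :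
    D.IsTransition l' i j := by
  rw [isTransition_iff hD.strictMono hσ hl] at ht
  rw [isTransition_iff hD.strictMono (by linarith) hl']
  obtain ⟨hij, S, hi, hj, h1, h2⟩ := ht
  have key : ∀ {a b : Fin M}, a ∉ S → b ∉ S → a ≠ b →
      (insert a S)ᶜ = insert b ((insert a (insert b S))ᶜ) := by
    intro a b ha hb hab
    ext m
    simp only [Finset.mem_compl, Finset.mem_insert, not_or]
    constructor
    · rintro ⟨h1, h2⟩
      by_cases hm : m = b
      · exact .inl hm
      · exact .inr ⟨h1, hm, h2⟩
    · rintro (rfl | ⟨h1, -, h2⟩)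
      · exact ⟨hab.symm, hb⟩
      · exact ⟨h1, h2⟩
  have h1' := h.isMaxBasis_compl hD h1
  have h2' := h.isMaxBasis_compl hD h2
  rw [key hi hj hij.ne] at h1'
  rw [key hj hi hij.ne', Finset.insert_comm j i] at h2'
  exact ⟨hij, _, by simp, by simp, h2', h1'⟩

end TauData

end KPII

/-! ### The pairing of pivot and non-pivot columns. -/

namespace KPII

open Submodule

namespace TauData

variable {N M : ℕ} {D : TauData N M}

theorem mem_span_compl_singleton (hD : D.Admissible) (m : Fin M) :
    cols D.A m ∈ span ℝ (cols D.A '' {m}ᶜ) := by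
  obtain ⟨-, B, hB, hm⟩ := exists_isColBasis_mem hD.rank hD.rref hD.irreducible m
  refine span_mono (Set.image_mono fun x hx => ?_) (hB.mem_span_image (cols D.A m))
  rintro rfl
  exact hm hx

theorem IsTransition.isPivot (hD : D.Admissible) {i j : Fin M} (h : D.IsTransition atTop i j) :
    IsPivot D.A i := by
  rw [isTransition_atTop_iff hD] at h
  rw [isPivot_iff hD.rank hD.rref]
  exact fun h' => h.2.1 (span_mono (Set.image_mono fun m hm => .inl hm) h')

theorem IsTransition.not_isPivot (hD : D.Admissible) {i j : Fin M}
    (h : D.IsTransition atBot i j) : ¬ IsPivot D.A j := by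
  rw [isTransition_atBot_iff hD] at h
  rw [isPivot_iff hD.rank hD.rref, not_not]
  exact span_mono (Set.image_mono fun m hm => hm.2) h.2.2

/-- As `j` grows, the set `{m | m < i ∨ j ≤ m}` shrinks from all columns but `i` to those before
`i`. Its span contains column `i` at the start (no coloops) and not at the end (pivot); the last `j`
for which it does is the partner. -/
theorem exists_isTransition_atTop (hD : D.Admissible) {i : Fin M} (hi : IsPivot D.A i) :
    ∃ j, D.IsTransition atTop i j := by
  classical
  rw [isPivot_iff hD.rank hD.rref] at hi
  simp only [isTransition_atTop_iff hD]
  set P := Finset.univ.filter fun j : Fin M => i < j ∧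
    cols D.A i ∈ span ℝ (cols D.A '' {m | m < i ∨ j ≤ m}) with hP
  have hne : P.Nonempty := by
    have h1 := mem_span_compl_singleton hD i
    have hlt : (i : ℕ) + 1 < M := by
      by_contra hlt
      refine hi (span_mono (Set.image_mono fun m hm => ?_) h1)
      have hm' : m ≠ i := hm
      have := m.2
      have : (m : ℕ) ≠ i := fun h => hm' (Fin.ext h)
      simp only [Set.mem_Iio, Fin.lt_def]
      omega
    refine ⟨⟨i + 1, hlt⟩, ?_⟩
    simp only [hP, Finset.mem_filter, Finset.mem_univ, true_and]
    refine ⟨by simp [Fin.lt_def], span_mono (Set.image_mono fun m hm => ?_) h1⟩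
    have hm' : m ≠ i := hm
    rcases lt_or_gt_of_ne hm' with h | h
    · exact .inl h
    · exact .inr h
  obtain ⟨j, hj, hmax⟩ := Finset.exists_max_image P id hne
  simp only [hP, Finset.mem_filter, Finset.mem_univ, true_and, id] at hj hmax
  refine ⟨j, hj.1, fun h => ?_, hj.2⟩
  have hlt : (j : ℕ) + 1 < M := by
    by_contra hlt
    refine hi (span_mono (Set.image_mono fun m hm => ?_) h)
    rcases hm with hm | hm
    · exact hm
    · have := m.2
      have : (j : ℕ) < m := hm
      omega
  have := hmax ⟨j + 1, hlt⟩ ⟨hj.1.trans (by simp [Fin.lt_def]),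
    span_mono (Set.image_mono fun m hm => ?_) h⟩
  · rw [Fin.le_def] at this
    simp at this
  · rcases hm with hm | hm
    · exact .inl hm
    · exact .inr hm

/-- The mirror argument: the span of the columns in `Set.Ico i j` contains column `j` when `i` is
the first column (non-pivot), but not when the interval is empty (no loops). Take the last such `i`.
-/
theorem exists_isTransition_atBot (hD : D.Admissible) {j : Fin M} (hj : ¬ IsPivot D.A j) :
    ∃ i, D.IsTransition atBot i j := by
  classical
  rw [isPivot_iff hD.rank hD.rref, not_not] at hj
  simp only [isTransition_atBot_iff hD]
  have hj0 : cols D.A j ≠ 0 := by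
    obtain ⟨n, hn⟩ := hD.irreducible.col j
    exact fun h => hn (congrFun h n)
  set P := Finset.univ.filter fun i : Fin M => i < j ∧
    cols D.A j ∈ span ℝ (cols D.A '' Set.Ico i j) with hP
  have hne : P.Nonempty := by
    have hlt : 0 < (j : ℕ) := by
      by_contra hlt
      refine hj0 ?_
      have : Set.Iio j = ∅ := by
        ext m
        simp only [Set.mem_Iio, Fin.lt_def, Set.mem_empty_iff_false, iff_false]
        omega
      simpa [this] using hj
    refine ⟨⟨0, by omega⟩, ?_⟩
    simp only [hP, Finset.mem_filter, Finset.mem_univ, true_and]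
    refine ⟨hlt, span_mono (Set.image_mono ?_) hj⟩
    exact fun m hm => ⟨Nat.zero_le _, hm⟩
  obtain ⟨i, hi, hmax⟩ := Finset.exists_max_image P id hne
  simp only [hP, Finset.mem_filter, Finset.mem_univ, true_and, id] at hi hmax
  refine ⟨i, hi.1, fun h => ?_, hi.2⟩
  have hij : (i : ℕ) < j := hi.1
  have hle : (i : ℕ) + 1 < j := by
    by_contra hle
    refine hj0 ?_
    have : Set.Ioo i j = ∅ := by
      ext m
      simp only [Set.mem_Ioo, Fin.lt_def, Set.mem_empty_iff_false, iff_false]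
      omega
    simpa [this] using h
  have hsub : Set.Ioo i j ⊆ Set.Ico ⟨i + 1, by omega⟩ j := fun m hm => ⟨hm.1, hm.2⟩
  have := hmax ⟨i + 1, by omega⟩ ⟨hle, span_mono (Set.image_mono hsub) h⟩
  rw [Fin.le_def] at this
  simp at this

theorem IsTransition.right_unique (hD : D.Admissible) {i j j' : Fin M}
    (h : D.IsTransition atTop i j) (h' : D.IsTransition atTop i j') : j = j' := by
  rw [isTransition_atTop_iff hD] at h h'
  have key : ∀ {a b : Fin M}, a < b →
      {m : Fin M | m < i ∨ b ≤ m} ⊆ {m | m < i ∨ a < m} := by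
    rintro a b hab m (hm | hm)
    · exact .inl hm
    · exact .inr (hab.trans_le hm)
  rcases lt_trichotomy j j' with hlt | rfl | hlt
  · exact absurd (span_mono (Set.image_mono (key hlt)) h'.2.2) h.2.1
  · rfl
  · exact absurd (span_mono (Set.image_mono (key hlt)) h.2.2) h'.2.1

theorem IsTransition.left_unique (hD : D.Admissible) {i i' j : Fin M}
    (h : D.IsTransition atBot i j) (h' : D.IsTransition atBot i' j) : i = i' := by
  rw [isTransition_atBot_iff hD] at h h'
  have key : ∀ {a b : Fin M}, a < b → Set.Ico b j ⊆ Set.Ioo a j :=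
    fun hab m hm => ⟨hab.trans_le hm.1, hm.2⟩
  rcases lt_trichotomy i i' with hlt | rfl | hlt
  · exact absurd (span_mono (Set.image_mono (key hlt)) h'.2.2) h.2.1
  · rfl
  · exact absurd (span_mono (Set.image_mono (key hlt)) h.2.2) h'.2.1

/-- The transitions of elastic data pair the pivot columns with the other columns. -/
theorem IsElastic.exists_pairing (hD : D.Admissible) (h : D.IsElastic) :
    ∃ e g : Fin N → Fin M,
      StrictMono e ∧ Function.Injective g ∧ (∀ n, e n < g n) ∧
      Set.range e = {m | IsPivot D.A m} ∧
      Set.range g = {m | ¬ IsPivot D.A m} ∧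
      IsCompl (Set.range e) (Set.range g) ∧
      {p : Fin M × Fin M | D.IsTransition atTop p.1 p.2} = Set.range (fun n => (e n, g n)) ∧
      {p : Fin M × Fin M | D.IsTransition atBot p.1 p.2} = Set.range (fun n => (e n, g n)) := by
  have hiff : ∀ i j, D.IsTransition atBot i j ↔ D.IsTransition atTop i j := fun i j =>
    ⟨h.isTransition_neg hD (by norm_num) tendsto_neg_one_mul_atBot
      (by simpa only [neg_neg] using tendsto_one_mul_atTop),
    h.isTransition_neg hD (by norm_num) tendsto_one_mul_atTop tendsto_neg_one_mul_atBot⟩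
  obtain ⟨e, hmono, he, hrange⟩ := exists_pivots hD.rank hD.rref
  choose g hg using fun n => exists_isTransition_atTop hD ⟨n, he n⟩
  have htop : {p : Fin M × Fin M | D.IsTransition atTop p.1 p.2} =
      Set.range (fun n => (e n, g n)) := by
    ext ⟨i, j⟩
    constructor
    · intro hp
      have hi : i ∈ Set.range e := hrange ▸ hp.isPivot hD
      obtain ⟨n, rfl⟩ := hi
      exact ⟨n, Prod.ext rfl ((hg n).right_unique hD hp)⟩
    · rintro ⟨n, hn⟩
      rw [Prod.ext_iff] at hn
      obtain ⟨rfl, rfl⟩ := hn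
      exact hg n
  have hgr : Set.range g = {m | ¬ IsPivot D.A m} := by
    ext m
    constructor
    · rintro ⟨n, rfl⟩
      exact ((hiff _ _).2 (hg n)).not_isPivot hD
    · intro hm
      obtain ⟨i, hi⟩ := exists_isTransition_atBot hD hm
      have : (i, m) ∈ {p : Fin M × Fin M | D.IsTransition atTop p.1 p.2} := (hiff _ _).1 hi
      rw [htop] at this
      obtain ⟨n, hn⟩ := this
      exact ⟨n, congrArg Prod.snd hn⟩
  refine ⟨e, g, hmono, fun n n' hn => ?_, fun n => (hg n).1, hrange, hgr, ?_, htop, ?_⟩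
  · refine hmono.injective (((hiff _ _).2 (hg n)).left_unique hD ?_)
    rw [hn]
    exact (hiff _ _).2 (hg n')
  · rw [hrange, hgr]
    exact isCompl_compl
  · simpa only [hiff] using htop

end TauData

end KPII

/-! ### Asymptotic line solitons from the dominant bases. -/

namespace KPII

section Solitons

theorem lineSoliton_line (a c δ ξ y t : ℝ) :
    lineSoliton ((c - a) / 2) ((c + a) / 2) δ (ξ - c * y) y t =
      lineSoliton ((c - a) / 2) ((c + a) / 2) δ ξ 0 t := by
  unfold lineSoliton linPhase
  congr 4
  ring

theorem lineSoliton_pos {p q : ℝ} (h : p ≠ q) (δ x y t : ℝ) : 0 < lineSoliton p q δ x y t := by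
  unfold lineSoliton
  have := Real.cosh_pos (1 / 2 * (linPhase q x y t - linPhase p x y t + δ))
  have h' : q - p ≠ 0 := sub_ne_zero.2 h.symm
  positivity

theorem lineSoliton_le (p q δ x y t : ℝ) :
    lineSoliton p q δ x y t ≤ 1 / 2 * (q - p) ^ 2 := by
  unfold lineSoliton
  refine div_le_self (by positivity) ?_
  have := Real.one_le_cosh (1 / 2 * (linPhase q x y t - linPhase p x y t + δ))
  exact one_le_pow₀ this

theorem exists_lineSoliton_eq {p q : ℝ} (h : p ≠ q) (δ : ℝ) :
    ∃ x, lineSoliton p q δ x 0 0 = 1 / 2 * (q - p) ^ 2 := by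
  have h' : q - p ≠ 0 := sub_ne_zero.2 h.symm
  refine ⟨-δ / (q - p), ?_⟩
  have : linPhase q (-δ / (q - p)) 0 0 - linPhase p (-δ / (q - p)) 0 0 + δ = 0 := by
    unfold linPhase
    field_simp
    ring
  rw [lineSoliton, this]
  simp

theorem continuous_lineSoliton (p q δ t : ℝ) : Continuous fun x => lineSoliton p q δ x 0 t := by
  unfold lineSoliton linPhase
  refine Continuous.div (by fun_prop) ?_ fun x => ?_
  · exact (Real.continuous_cosh.comp (by fun_prop)).pow 2
  · exact pow_ne_zero _ (Real.cosh_pos _).ne'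

/-- The right side is `2 (log τ)_xx` for `τ` a sum of two exponentials with current values `α`, `β`
and rates differing by `q - p`. -/
theorem lineSoliton_eq_of_exp {p q δ x y t α β : ℝ} (hα : 0 < α) (hβ : 0 < β)
    (h : Real.exp (linPhase q x y t - linPhase p x y t + δ) = β / α) :
    lineSoliton p q δ x y t = 2 * (α * β * (q - p) ^ 2) / (α + β) ^ 2 := by
  unfold lineSoliton
  set z := linPhase q x y t - linPhase p x y t + δ with hz
  have h1 : Real.cosh (1 / 2 * z) ^ 2 = (Real.cosh z + 1) / 2 := by
    have h2 := Real.cosh_two_mul (1 / 2 * z)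
    have h3 := Real.cosh_sq (1 / 2 * z)
    have h4 : 2 * (1 / 2 * z) = z := by ring
    rw [h4] at h2
    linarith
  rw [h1, Real.cosh_eq, Real.exp_neg, h]
  field_simp
  ring

/-- The soliton is constant along its lines and continuous in `ξ`, so locally uniform convergence
becomes a joint limit in `(y, ξ)`. -/
theorem hasLineSoliton_iff {u : ℝ → ℝ → ℝ → ℝ} {l : Filter ℝ} {a c : ℝ} :
    HasLineSoliton u l a c ↔ 0 < a ∧ ∃ δ : ℝ, ∀ t ξ : ℝ,
      Tendsto (fun p : ℝ × ℝ => u (p.2 - c * p.1) p.1 t) (l ×ˢ 𝓝 ξ)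
        (𝓝 (lineSoliton ((c - a) / 2) ((c + a) / 2) δ ξ 0 t)) := by
  unfold HasLineSoliton
  simp only [tendstoLocallyUniformly_iff_forall_tendsto, ← Uniform.tendsto_nhds_right,
    lineSoliton_line]
  refine and_congr_right fun _ => exists_congr fun δ => forall_congr' fun t =>
    forall_congr' fun ξ => ?_
  have hcont : Tendsto (fun p : ℝ × ℝ => lineSoliton ((c - a) / 2) ((c + a) / 2) δ p.2 0 t)
      (l ×ˢ 𝓝 ξ) (𝓝 (lineSoliton ((c - a) / 2) ((c + a) / 2) δ ξ 0 t)) :=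
    ((continuous_lineSoliton _ _ δ t).tendsto ξ).comp tendsto_snd
  constructor
  · intro h
    simpa using h.add hcont
  · intro h
    simpa using h.sub hcont

end Solitons

namespace TauData

variable {N M : ℕ} {D : TauData N M}

/-- The phase parameter of a phase combination. -/
def kSum (D : TauData N M) (S : Finset (Fin M)) : ℝ := ∑ m ∈ S, D.k m

theorem setCoeff_pos (hD : D.Admissible) {S : Finset (Fin M)} (hS : IsColBasis (cols D.A) S) :
    0 < D.setCoeff S := by
  have h := (D.mem_phaseSet_iff.1 ((mem_phaseSet_iff_isColBasis hD.strictMono).2 hS))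
  rw [setCoeff, dif_pos hS.1] at h ⊢
  have hm : minor D.A (S.orderEmbOfFin hS.1) ≠ 0 := left_ne_zero_of_mul h
  exact mul_pos (hD.minor_pos _ hm) (vander_pos hD.strictMono (S.orderEmbOfFin hS.1).strictMono)

theorem setCoeff_eq_zero (hD : D.Admissible) {S : Finset (Fin M)}
    (hS : ¬ IsColBasis (cols D.A) S) : D.setCoeff S = 0 := by
  by_contra h
  exact hS ((mem_phaseSet_iff_isColBasis hD.strictMono).1 (D.mem_phaseSet_iff.2 h))

theorem setCoeff_nonneg (hD : D.Admissible) (S : Finset (Fin M)) : 0 ≤ D.setCoeff S := by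
  by_cases hS : IsColBasis (cols D.A) S
  · exact (setCoeff_pos hD hS).le
  · exact (setCoeff_eq_zero hD hS).ge

theorem tau_pos (hD : D.Admissible) (x y t : ℝ) : 0 < D.tau x y t := by
  rw [tau_eq_sum]
  obtain ⟨B, hB⟩ := exists_isColBasis hD
  exact Finset.sum_pos' (fun S _ => mul_nonneg (setCoeff_nonneg hD S) (Real.exp_pos _).le)
    ⟨B, Finset.mem_univ _, mul_pos (setCoeff_pos hD hB) (Real.exp_pos _)⟩

/-- The `j`-th `x`-derivative of the `τ`-function. -/
def tauDeriv (D : TauData N M) (j : ℕ) (x y t : ℝ) : ℝ :=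
  ∑ S, D.setCoeff S * D.kSum S ^ j * Real.exp (D.phaseSum S x y t)

theorem tauDeriv_zero (x y t : ℝ) : D.tauDeriv 0 x y t = D.tau x y t := by
  simp [tauDeriv, tau_eq_sum]

theorem hasDerivAt_tauDeriv (j : ℕ) (x y t : ℝ) :
    HasDerivAt (fun x' => D.tauDeriv j x' y t) (D.tauDeriv (j + 1) x y t) x := by
  unfold tauDeriv
  refine HasDerivAt.fun_sum fun S _ => ?_
  have h : HasDerivAt (fun x' => D.phaseSum S x' y t) (D.kSum S) x := by
    refine HasDerivAt.fun_sum fun m _ => ?_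
    have := (((hasDerivAt_id x).const_mul (D.k m)).add_const (D.k m ^ 2 * y)).add_const
      (D.k m ^ 3 * t) |>.add_const (D.θ₀ m)
    simpa [phase, linPhase] using this
  exact (h.exp.const_mul (D.setCoeff S * D.kSum S ^ j)).congr_deriv (by ring)

theorem sol_eq (hD : D.Admissible) (x y t : ℝ) :
    D.sol x y t = 2 * ((D.tauDeriv 2 x y t * D.tauDeriv 0 x y t - D.tauDeriv 1 x y t ^ 2) /
      D.tauDeriv 0 x y t ^ 2) := by
  have hne : ∀ x, D.tauDeriv 0 x y t ≠ 0 := fun x => by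
    rw [tauDeriv_zero]; exact (tau_pos hD x y t).ne'
  rw [sol, iteratedDeriv_succ, iteratedDeriv_one]
  simp only [← tauDeriv_zero]
  have h1 : deriv (fun x' => Real.log (D.tauDeriv 0 x' y t)) =
      fun x' => D.tauDeriv 1 x' y t / D.tauDeriv 0 x' y t :=
    funext fun x' => ((hasDerivAt_tauDeriv 0 x' y t).log (hne x')).deriv
  rw [h1, ((hasDerivAt_tauDeriv 1 x y t).fun_div (hasDerivAt_tauDeriv 0 x y t) (hne x)).deriv]
  ring

open Classical in
/-- The part of the `j`-th derivative of the `τ`-function which dominates along the lines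
`x + c y = ξ`, up to an exponential factor. -/
def dominantPart (D : TauData N M) (σ c : ℝ) (j : ℕ) (ξ t : ℝ) : ℝ :=
  ∑ S with IsMaxBasis (cols D.A) (D.weight σ c) S,
    D.setCoeff S * D.kSum S ^ j * Real.exp (∑ m ∈ S, D.offset ξ t m)

theorem tendsto_tauDeriv (hD : D.Admissible) {l : Filter ℝ} {σ : ℝ} (hσ : σ * σ = 1)
    (hl : Tendsto (fun y => σ * y) l atTop) {c : ℝ} {B : Finset (Fin M)}
    (hB : IsMaxBasis (cols D.A) (D.weight σ c) B) (j : ℕ) (ξ t : ℝ) :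
    Tendsto (fun p : ℝ × ℝ => Real.exp (-(∑ m ∈ B, D.weight σ c m) * (σ * p.1)) *
      D.tauDeriv j (p.2 - c * p.1) p.1 t) (l ×ˢ 𝓝 ξ) (𝓝 (D.dominantPart σ c j ξ t)) := by
  classical
  unfold tauDeriv dominantPart
  simp only [Finset.mul_sum, Finset.sum_filter]
  refine tendsto_finsetSum _ fun S _ => ?_
  simp only [phaseSum_line hσ]
  have hoff : Tendsto (fun p : ℝ × ℝ => Real.exp (∑ m ∈ S, D.offset p.2 t m)) (l ×ˢ 𝓝 ξ)
      (𝓝 (Real.exp (∑ m ∈ S, D.offset ξ t m))) := by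
    have : Continuous fun ξ => Real.exp (∑ m ∈ S, D.offset ξ t m) := by
      unfold offset; fun_prop
    exact (this.tendsto ξ).comp tendsto_snd
  have hσl : Tendsto (fun p : ℝ × ℝ => σ * p.1) (l ×ˢ 𝓝 ξ) atTop := hl.comp tendsto_fst
  have heq : ∀ p : ℝ × ℝ, Real.exp (-(∑ m ∈ B, D.weight σ c m) * (σ * p.1)) *
      (D.setCoeff S * D.kSum S ^ j * Real.exp ((∑ m ∈ S, D.weight σ c m) * (σ * p.1) +
        ∑ m ∈ S, D.offset p.2 t m)) = D.setCoeff S * D.kSum S ^ j *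
      Real.exp ((∑ m ∈ S, D.weight σ c m - ∑ m ∈ B, D.weight σ c m) * (σ * p.1)) *
        Real.exp (∑ m ∈ S, D.offset p.2 t m) := by
    intro p
    rw [Real.exp_add, sub_mul, sub_eq_add_neg, Real.exp_add, neg_mul]
    ring
  simp only [heq]
  by_cases hS : IsColBasis (cols D.A) S
  · have hle := hB.2 S hS
    split_ifs with hmax
    · have : ∑ m ∈ S, D.weight σ c m - ∑ m ∈ B, D.weight σ c m = 0 := by
        have := hmax.2 B hB.1
        linarith
      simpa [this] using hoff.const_mul (D.setCoeff S * D.kSum S ^ j)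
    · have hlt : ∑ m ∈ S, D.weight σ c m - ∑ m ∈ B, D.weight σ c m < 0 := by
        rw [sub_neg]
        refine lt_of_le_of_ne hle fun h => hmax ⟨hS, fun T hT => ?_⟩
        rw [h]
        exact hB.2 T hT
      have h0 := Real.tendsto_exp_atBot.comp (hσl.const_mul_atTop_of_neg hlt)
      simpa using (h0.const_mul (D.setCoeff S * D.kSum S ^ j)).mul hoff
  · have hmax : ¬ IsMaxBasis (cols D.A) (D.weight σ c) S := fun h => hS h.1
    simpa [setCoeff_eq_zero hD hS] using tendsto_const_nhds

theorem dominantPart_zero_pos (hD : D.Admissible) {σ c : ℝ} {B : Finset (Fin M)}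
    (hB : IsMaxBasis (cols D.A) (D.weight σ c) B) (ξ t : ℝ) :
    0 < D.dominantPart σ c 0 ξ t := by
  classical
  unfold dominantPart
  refine Finset.sum_pos (fun S hS => ?_) ⟨B, by simpa using hB⟩
  simp only [Finset.mem_filter, Finset.mem_univ, true_and] at hS
  simpa using mul_pos (setCoeff_pos hD hS.1) (Real.exp_pos _)

/-- The formula in `sol_eq` is homogeneous of degree zero, so the exponential normalization of
`tendsto_tauDeriv` cancels. -/
theorem tendsto_sol (hD : D.Admissible) {l : Filter ℝ} {σ : ℝ} (hσ : σ * σ = 1)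
    (hl : Tendsto (fun y => σ * y) l atTop) (c ξ t : ℝ) :
    Tendsto (fun p : ℝ × ℝ => D.sol (p.2 - c * p.1) p.1 t) (l ×ˢ 𝓝 ξ)
      (𝓝 (2 * ((D.dominantPart σ c 2 ξ t * D.dominantPart σ c 0 ξ t -
        D.dominantPart σ c 1 ξ t ^ 2) / D.dominantPart σ c 0 ξ t ^ 2))) := by
  obtain ⟨B₀, hB₀⟩ := exists_isColBasis hD
  obtain ⟨B, hB⟩ := exists_isMaxBasis (D.weight σ c) hB₀
  have h := fun j => tendsto_tauDeriv hD hσ hl hB j ξ t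
  have hpos := dominantPart_zero_pos hD hB ξ t
  refine (((((h 2).mul (h 0)).sub ((h 1).pow 2)).div ((h 0).pow 2)
    (pow_ne_zero _ hpos.ne')).const_mul 2).congr fun p => ?_
  rw [sol_eq hD]
  have he := (Real.exp_pos (-(∑ m ∈ B, D.weight σ c m) * (σ * p.1))).ne'
  congr 1
  have hτ : D.tauDeriv 0 (p.2 - c * p.1) p.1 t ≠ 0 := by
    rw [tauDeriv_zero]; exact (tau_pos hD _ _ _).ne'
  simp only [Pi.div_apply]
  field_simp

theorem IsMaxBasis.exists_transition (hk : StrictMono D.k) {l : Filter ℝ} [l.NeBot] {σ c : ℝ}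
    (hσ : σ * σ = 1) (hl : Tendsto (fun y => σ * y) l atTop) {B B' : Finset (Fin M)}
    (hB : IsMaxBasis (cols D.A) (D.weight σ c) B) (hB' : IsMaxBasis (cols D.A) (D.weight σ c) B')
    {i : Fin M} (hi : i ∈ B) (hi' : i ∉ B') :
    ∃ j ∈ B', j ∉ B ∧ D.k i + D.k j = c ∧ (D.IsTransition l i j ∨ D.IsTransition l j i) := by
  obtain ⟨j, hj, hjB, hw, hmax⟩ := hB.exists_exchange hB' hi hi'
  have hij : i ≠ j := fun h => hi' (h ▸ hj)
  have hc : D.k i + D.k j = c := by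
    have hσ0 : σ ≠ 0 := by rintro rfl; simp at hσ
    have hk' : D.k i - D.k j ≠ 0 := sub_ne_zero.2 (hk.injective.ne hij)
    have : σ * ((D.k i - D.k j) * (D.k i + D.k j - c)) = 0 := by
      unfold weight at hw
      linear_combination hw
    have := ((mul_eq_zero.1 this).resolve_left hσ0 |> mul_eq_zero.1).resolve_left hk'
    linarith
  refine ⟨j, hj, hjB, hc, ?_⟩
  rw [isTransition_iff hk hσ hl, isTransition_iff hk hσ hl, add_comm (D.k j), hc]
  have hB1 : IsMaxBasis (cols D.A) (D.weight σ c) (insert i (B.erase i)) := by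
    rwa [Finset.insert_erase hi]
  rcases lt_or_gt_of_ne hij with h | h
  · exact .inl ⟨h, B.erase i, by simp, by simp [hjB], hB1, hmax⟩
  · exact .inr ⟨h, B.erase i, by simp [hjB], by simp, hmax, hB1⟩

/-- The set of single-phase transitions in a given direction has at most one element. -/
def GenericTransitions (D : TauData N M) (l : Filter ℝ) : Prop :=
  ∀ i j i' j', D.IsTransition l i j → D.IsTransition l i' j' →
    D.k i + D.k j = D.k i' + D.k j' → i = i' ∧ j = j'

/-- An index in one maximal basis but not in another belongs to a transition of the same direction,
which by genericity is `i → j`. So maximal bases differ only in `i` and `j`. -/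
theorem IsTransition.isMaxBasis_iff (hk : StrictMono D.k) {l : Filter ℝ} [l.NeBot] {σ : ℝ}
    (hσ : σ * σ = 1) (hl : Tendsto (fun y => σ * y) l atTop) (hgen : D.GenericTransitions l)
    {i j : Fin M} (h : D.IsTransition l i j) :
    ∃ S, i ∉ S ∧ j ∉ S ∧ ∀ B, IsMaxBasis (cols D.A) (D.weight σ (D.k i + D.k j)) B ↔
      B = insert i S ∨ B = insert j S := by
  obtain ⟨hij, S, hi, hj, h1, h2⟩ := (isTransition_iff hk hσ hl i j).1 h
  refine ⟨S, hi, hj, fun B => ⟨fun hB => ?_, ?_⟩⟩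
  · have hsub : ∀ {B B' : Finset (Fin M)},
        IsMaxBasis (cols D.A) (D.weight σ (D.k i + D.k j)) B →
        IsMaxBasis (cols D.A) (D.weight σ (D.k i + D.k j)) B' →
        ∀ m ∈ B, m ∉ B' → m = i ∨ m = j := by
      intro B B' hB hB' m hm hm'
      obtain ⟨m', -, -, hc, ht | ht⟩ := IsMaxBasis.exists_transition hk hσ hl hB hB' hm hm'
      · exact .inl (hgen _ _ _ _ ht h hc).1
      · exact .inr (hgen _ _ _ _ ht h (by rw [← hc, add_comm])).2
    have hcard : B.card = S.card + 1 := by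
      rw [hB.1.1, ← h1.1.1, Finset.card_insert_of_notMem hi]
    have hSB : S ⊆ B := by
      intro m hm
      by_contra hmB
      rcases hsub h1 hB m (Finset.mem_insert_of_mem hm) hmB with rfl | rfl
      · exact hi hm
      · exact hj hm
    obtain ⟨x, hxS, rfl⟩ : ∃ x, x ∉ S ∧ insert x S = B := by
      have : (B \ S).card = 1 := by
        rw [Finset.card_sdiff_of_subset hSB]; omega
      obtain ⟨x, hx⟩ := Finset.card_eq_one.1 this
      have hx' : x ∈ B \ S := by simp [hx]
      refine ⟨x, (Finset.mem_sdiff.1 hx').2, ?_⟩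
      rw [← Finset.sdiff_union_of_subset hSB, hx]
      rfl
    by_cases hxi : x = i
    · exact .inl (by rw [hxi])
    · rcases hsub hB h1 x (Finset.mem_insert_self _ _) (by simp [hxi, hxS]) with rfl | rfl
      · exact .inl rfl
      · exact .inr rfl
  · rintro (rfl | rfl)
    · exact h1
    · exact h2

theorem dominantPart_of_pair {σ c : ℝ} {B B' : Finset (Fin M)} (hne : B ≠ B')
    (h : ∀ S, IsMaxBasis (cols D.A) (D.weight σ c) S ↔ S = B ∨ S = B') (j : ℕ) (ξ t : ℝ) :
    D.dominantPart σ c j ξ t =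
      D.setCoeff B * D.kSum B ^ j * Real.exp (∑ m ∈ B, D.offset ξ t m) +
        D.setCoeff B' * D.kSum B' ^ j * Real.exp (∑ m ∈ B', D.offset ξ t m) := by
  classical
  unfold dominantPart
  rw [← Finset.sum_pair (f := fun S => D.setCoeff S * D.kSum S ^ j *
    Real.exp (∑ m ∈ S, D.offset ξ t m)) hne]
  refine Finset.sum_congr ?_ fun _ _ => rfl
  ext S
  simp [h]

theorem dominantPart_of_unique {σ c : ℝ} {B : Finset (Fin M)}
    (h : ∀ S, IsMaxBasis (cols D.A) (D.weight σ c) S ↔ S = B) (j : ℕ) (ξ t : ℝ) :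
    D.dominantPart σ c j ξ t =
      D.setCoeff B * D.kSum B ^ j * Real.exp (∑ m ∈ B, D.offset ξ t m) := by
  classical
  unfold dominantPart
  rw [← Finset.sum_singleton (fun S => D.setCoeff S * D.kSum S ^ j *
    Real.exp (∑ m ∈ S, D.offset ξ t m)) B]
  refine Finset.sum_congr ?_ fun _ _ => rfl
  ext S
  simp [h]

theorem IsTransition.exists_tendsto (hD : D.Admissible) {l : Filter ℝ} [l.NeBot] {σ : ℝ}
    (hσ : σ * σ = 1) (hl : Tendsto (fun y => σ * y) l atTop) (hgen : D.GenericTransitions l)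
    {i j : Fin M} (h : D.IsTransition l i j) :
    ∃ δ, ∀ t ξ : ℝ, Tendsto (fun p : ℝ × ℝ => D.sol (p.2 - (D.k i + D.k j) * p.1) p.1 t)
      (l ×ˢ 𝓝 ξ) (𝓝 (lineSoliton (D.k i) (D.k j) δ ξ 0 t)) := by
  obtain ⟨S, hi, hj, hS⟩ := h.isMaxBasis_iff hD.strictMono hσ hl hgen
  have hij : i ≠ j := h.1.ne
  have hci := setCoeff_pos hD ((hS _).2 (.inl rfl)).1
  have hcj := setCoeff_pos hD ((hS _).2 (.inr rfl)).1
  refine ⟨D.θ₀ j - D.θ₀ i +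
    Real.log (D.setCoeff (insert j S) / D.setCoeff (insert i S)), fun t ξ => ?_⟩
  have hlim := tendsto_sol hD hσ hl (D.k i + D.k j) ξ t
  have hne : insert i S ≠ insert j S := by
    intro heq
    have : i ∈ insert j S := heq ▸ Finset.mem_insert_self i S
    simp [hij, hi] at this
  simp only [dominantPart_of_pair hne hS] at hlim
  convert hlim using 2
  have hki : D.kSum (insert i S) = D.k i + D.kSum S := Finset.sum_insert hi
  have hkj : D.kSum (insert j S) = D.k j + D.kSum S := Finset.sum_insert hj
  set α := D.setCoeff (insert i S) * Real.exp (∑ m ∈ insert i S, D.offset ξ t m) with hα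
  set β := D.setCoeff (insert j S) * Real.exp (∑ m ∈ insert j S, D.offset ξ t m) with hβ
  have hα0 : 0 < α := mul_pos hci (Real.exp_pos _)
  have hβ0 : 0 < β := mul_pos hcj (Real.exp_pos _)
  rw [lineSoliton_eq_of_exp hα0 hβ0]
  · rw [hki, hkj, mul_div_assoc]
    have e1 : ∀ n, D.setCoeff (insert i S) * (D.k i + D.kSum S) ^ n *
        Real.exp (∑ m ∈ insert i S, D.offset ξ t m) = α * (D.k i + D.kSum S) ^ n := fun n => by
      rw [hα]; ring
    have e2 : ∀ n, D.setCoeff (insert j S) * (D.k j + D.kSum S) ^ n *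
        Real.exp (∑ m ∈ insert j S, D.offset ξ t m) = β * (D.k j + D.kSum S) ^ n := fun n => by
      rw [hβ]; ring
    simp only [e1, e2]
    congr 2
    · ring
    · ring
  · rw [← add_assoc, Real.exp_add, Real.exp_log (div_pos hcj hci), hα, hβ, Finset.sum_insert hi,
      Finset.sum_insert hj]
    have : linPhase (D.k j) ξ 0 t - linPhase (D.k i) ξ 0 t + (D.θ₀ j - D.θ₀ i) =
        D.offset ξ t j - D.offset ξ t i := by
      unfold linPhase offset; ring
    rw [this, Real.exp_sub, Real.exp_add, Real.exp_add]
    have e1 := Real.exp_pos (D.offset ξ t i)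
    have e2 := Real.exp_pos (∑ m ∈ S, D.offset ξ t m)
    field_simp

theorem tendsto_sol_zero (hD : D.Admissible) {l : Filter ℝ} [l.NeBot] {σ c : ℝ}
    (hσ : σ * σ = 1) (hl : Tendsto (fun y => σ * y) l atTop)
    (h : ∀ i j, D.IsTransition l i j → D.k i + D.k j ≠ c) (t ξ : ℝ) :
    Tendsto (fun p : ℝ × ℝ => D.sol (p.2 - c * p.1) p.1 t) (l ×ˢ 𝓝 ξ) (𝓝 0) := by
  obtain ⟨B₀, hB₀⟩ := exists_isColBasis hD
  obtain ⟨B, hB⟩ := exists_isMaxBasis (D.weight σ c) hB₀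
  have huniq : ∀ S, IsMaxBasis (cols D.A) (D.weight σ c) S ↔ S = B := by
    refine fun S => ⟨fun hS => ?_, fun h => h ▸ hB⟩
    refine Finset.eq_of_subset_of_card_le (fun i hi => ?_) (by rw [hB.1.1, hS.1.1])
    by_contra hiB
    obtain ⟨j, -, -, hc, ht | ht⟩ :=
      IsMaxBasis.exists_transition hD.strictMono hσ hl hS hB hi hiB
    · exact h _ _ ht hc
    · exact h _ _ ht (by rw [add_comm, hc])
  have hlim := tendsto_sol hD hσ hl c ξ t
  simp only [dominantPart_of_unique huniq] at hlim
  convert hlim using 2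
  ring

/-- In a direction without transitions the limit is zero, which no soliton is. In a direction with
one, uniqueness of limits equates two profiles, and their maxima `a ^ 2 / 2` determine the
amplitude. -/
theorem hasLineSoliton_sol_iff (hD : D.Admissible) {l : Filter ℝ} [l.NeBot] {σ : ℝ}
    (hσ : σ * σ = 1) (hl : Tendsto (fun y => σ * y) l atTop) (hgen : D.GenericTransitions l)
    (a c : ℝ) :
    HasLineSoliton D.sol l a c ↔
      ∃ i j, D.IsTransition l i j ∧ a = D.k j - D.k i ∧ c = D.k j + D.k i := by
  constructor
  · intro h
    obtain ⟨ha, δ, h⟩ := hasLineSoliton_iff.1 h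
    have hpq : (c - a) / 2 ≠ (c + a) / 2 := fun h => by linarith
    by_cases htr : ∃ i j, D.IsTransition l i j ∧ D.k i + D.k j = c
    · obtain ⟨i, j, ht, rfl⟩ := htr
      refine ⟨i, j, ht, ?_, add_comm _ _⟩
      obtain ⟨δ', h'⟩ := ht.exists_tendsto hD hσ hl hgen
      have heq := fun ξ => tendsto_nhds_unique (h 0 ξ) (h' 0 ξ)
      have hk : D.k i < D.k j := hD.strictMono ht.1
      obtain ⟨x, hx⟩ := exists_lineSoliton_eq hpq δ
      obtain ⟨x', hx'⟩ := exists_lineSoliton_eq hk.ne δ'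
      have l1 := lineSoliton_le (D.k i) (D.k j) δ' x 0 0
      have l2 := lineSoliton_le ((D.k i + D.k j - a) / 2) ((D.k i + D.k j + a) / 2) δ x' 0 0
      rw [← heq, hx] at l1
      rw [heq, hx'] at l2
      have hsq : a ^ 2 = (D.k j - D.k i) ^ 2 := by nlinarith
      exact (pow_left_inj₀ ha.le (sub_pos.2 hk).le two_ne_zero).1 hsq
    · push Not at htr
      have h0 := tendsto_nhds_unique (h 0 0) (tendsto_sol_zero hD hσ hl htr 0 0)
      exact absurd h0 (lineSoliton_pos hpq _ _ _ _).ne'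
  · rintro ⟨i, j, ht, rfl, rfl⟩
    rw [hasLineSoliton_iff]
    obtain ⟨δ, h⟩ := ht.exists_tendsto hD hσ hl hgen
    refine ⟨sub_pos.2 (hD.strictMono ht.1), δ, fun t ξ => ?_⟩
    have e1 : (D.k j + D.k i - (D.k j - D.k i)) / 2 = D.k i := by ring
    have e2 : (D.k j + D.k i + (D.k j - D.k i)) / 2 = D.k j := by ring
    rw [e1, e2, add_comm]
    exact h t ξ

/-- If the transitions as `y → ±∞` have distinct directions, then the asymptotic line solitons
are labelled by them. -/
theorem lineSolitons_eq (hD : D.Admissible) {l : Filter ℝ} [l.NeBot] {σ : ℝ}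
    (hσ : σ * σ = 1) (hl : Tendsto (fun y => σ * y) l atTop) {e g : Fin N → Fin M}
    (ht : {p : Fin M × Fin M | D.IsTransition l p.1 p.2} = Set.range (fun n => (e n, g n)))
    (hinj : Function.Injective (fun n => D.k (e n) + D.k (g n))) :
    {p : Fin M × Fin M | D.IsAsymptoticLineSoliton l p.1 p.2} =
        Set.range (fun n => (e n, g n)) ∧
      {q : ℝ × ℝ | HasLineSoliton D.sol l q.1 q.2} =
        Set.range (fun n => (D.k (g n) - D.k (e n), D.k (g n) + D.k (e n))) := by
  have htr : ∀ i j, D.IsTransition l i j ↔ ∃ n, e n = i ∧ g n = j := by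
    intro i j
    have : (i, j) ∈ {p : Fin M × Fin M | D.IsTransition l p.1 p.2} ↔
      (i, j) ∈ Set.range (fun n => (e n, g n)) := by rw [ht]
    simpa using this
  have hgen : D.GenericTransitions l := by
    intro i j i' j' h h' hk
    obtain ⟨n, rfl, rfl⟩ := (htr _ _).1 h
    obtain ⟨n', rfl, rfl⟩ := (htr _ _).1 h'
    have : n = n' := hinj hk
    exact ⟨by rw [this], by rw [this]⟩
  have hsol := hasLineSoliton_sol_iff hD hσ hl hgen
  constructor
  · rw [← ht]
    ext ⟨i, j⟩
    simp only [Set.mem_ofPred_eq, IsAsymptoticLineSoliton, hsol]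
    constructor
    · rintro ⟨-, i', j', h, h1, h2⟩
      have hi : i = i' := hD.strictMono.injective (by linarith)
      have hj : j = j' := hD.strictMono.injective (by linarith)
      rwa [hi, hj]
    · intro h
      exact ⟨h.1, i, j, h, rfl, rfl⟩
  · ext ⟨a, c⟩
    simp only [Set.mem_ofPred_eq, hsol, Set.mem_range, Prod.mk.injEq, htr]
    constructor
    · rintro ⟨_, _, ⟨n, rfl, rfl⟩, rfl, rfl⟩
      exact ⟨n, rfl, rfl⟩
    · rintro ⟨n, rfl, rfl⟩
      exact ⟨_, _, ⟨n, rfl, rfl⟩, rfl, rfl⟩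

end TauData

end KPII

/-! ### Complementary minors, the dual matrix and the inverted solution. -/

namespace KPII

open Matrix Submodule

section ComplementaryMinors

variable {N N' M : ℕ}

/-- Jacobi's identity for complementary minors of a matrix and its inverse. -/
theorem det_mul_det_fromCols {A : Matrix (Fin N) (Fin M) ℝ} {X : Matrix (Fin M) (Fin N) ℝ}
    {Y : Matrix (Fin M) (Fin N') ℝ} (hX : A * X = 1) (hY : A * Y = 0)
    (ε : Fin N ⊕ Fin N' ≃ Fin M) :
    (A.submatrix id (ε ∘ Sum.inl)).det * ((fromCols X Y).submatrix ε id).det =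
      (Y.submatrix (ε ∘ Sum.inr) id).det := by
  have h1 : (fromCols X Y).submatrix ε id = fromBlocks (X.submatrix (ε ∘ Sum.inl) id)
      (Y.submatrix (ε ∘ Sum.inl) id) (X.submatrix (ε ∘ Sum.inr) id)
      (Y.submatrix (ε ∘ Sum.inr) id) := by
    ext (i | i) (j | j) <;> simp
  have hsum : ∀ {n : ℕ} (Z : Matrix (Fin M) (Fin n) ℝ),
      A.submatrix id (ε ∘ Sum.inl) * Z.submatrix (ε ∘ Sum.inl) id +
        A.submatrix id (ε ∘ Sum.inr) * Z.submatrix (ε ∘ Sum.inr) id = A * Z := by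
    intro n Z
    ext i j
    simp only [Matrix.add_apply, mul_apply, submatrix_apply, id, Function.comp]
    rw [← Equiv.sum_comp ε, Fintype.sum_sum_type]
  have h2 : fromBlocks (A.submatrix id (ε ∘ Sum.inl)) (A.submatrix id (ε ∘ Sum.inr)) 0 1 *
      (fromCols X Y).submatrix ε id =
      fromBlocks 1 0 (X.submatrix (ε ∘ Sum.inr) id) (Y.submatrix (ε ∘ Sum.inr) id) := by
    rw [h1, fromBlocks_multiply, hsum, hsum, hX, hY]
    simp
  have h3 := congrArg det h2
  rw [det_mul, det_fromBlocks_zero₂₁, det_fromBlocks_zero₁₂, det_one, det_one, mul_one,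
    one_mul] at h3
  exact h3

theorem det_submatrix_equiv_eq_sign (P : Matrix (Fin M) (Fin N ⊕ Fin N') ℝ)
    (ε ε₀ : Fin N ⊕ Fin N' ≃ Fin M) :
    (P.submatrix ε id).det =
      Equiv.Perm.sign (ε.trans ε₀.symm) * (P.submatrix ε₀ id).det := by
  rw [← det_permute]
  congr 1
  ext i j
  simp

theorem exists_right_inverse {A : Matrix (Fin N) (Fin M) ℝ} {m : Fin N → Fin M}
    (h : (A.submatrix id m).det ≠ 0) : ∃ X : Matrix (Fin M) (Fin N) ℝ, A * X = 1 := by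
  refine ⟨(1 : Matrix (Fin M) (Fin M) ℝ).submatrix id m * (A.submatrix id m)⁻¹, ?_⟩
  have : A * (1 : Matrix (Fin M) (Fin M) ℝ).submatrix id m = A.submatrix id m := by
    ext i j
    simp [mul_apply, one_apply]
  rw [← Matrix.mul_assoc, this, mul_nonsing_inv _ (isUnit_iff_ne_zero.2 h)]

/-- The complementary minors of two pairs of orthogonal matrices are proportional. -/
theorem exists_det_mul_det_eq {A A₂ : Matrix (Fin N) (Fin M) ℝ} {X X₂ : Matrix (Fin M) (Fin N) ℝ}
    {Y Y₂ : Matrix (Fin M) (Fin N') ℝ} (hX : A * X = 1) (hY : A * Y = 0) (hX₂ : A₂ * X₂ = 1)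
    (hY₂ : A₂ * Y₂ = 0) (ε₀ : Fin N ⊕ Fin N' ≃ Fin M)
    (h : (Y.submatrix (ε₀ ∘ Sum.inr) id).det ≠ 0)
    (h₂ : (Y₂.submatrix (ε₀ ∘ Sum.inr) id).det ≠ 0) :
    ∃ ρ d : ℝ, ρ ≠ 0 ∧ 0 < d ∧ ∀ ε : Fin N ⊕ Fin N' ≃ Fin M,
      (Y.submatrix (ε ∘ Sum.inr) id).det * (A₂.submatrix id (ε ∘ Sum.inl)).det =
        ρ * (A.submatrix id (ε ∘ Sum.inl)).det * (Y₂.submatrix (ε ∘ Sum.inr) id).det ∧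
      |(A₂.submatrix id (ε ∘ Sum.inl)).det| * d = |(Y₂.submatrix (ε ∘ Sum.inr) id).det| := by
  have hd := det_mul_det_fromCols hX hY
  have hd₂ := det_mul_det_fromCols hX₂ hY₂
  have n1 : ((fromCols X Y).submatrix ε₀ id).det ≠ 0 := by
    rw [← hd] at h; exact right_ne_zero_of_mul h
  have n2 : ((fromCols X₂ Y₂).submatrix ε₀ id).det ≠ 0 := by
    rw [← hd₂] at h₂; exact right_ne_zero_of_mul h₂
  refine ⟨((fromCols X Y).submatrix ε₀ id).det / ((fromCols X₂ Y₂).submatrix ε₀ id).det,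
    |((fromCols X₂ Y₂).submatrix ε₀ id).det|, div_ne_zero n1 n2, abs_pos.2 n2, fun ε => ?_⟩
  -- Both Jacobi identities carry the same permutation sign, so it drops out of their quotient.
  rw [← hd, ← hd₂, det_submatrix_equiv_eq_sign (fromCols X Y) ε ε₀,
    det_submatrix_equiv_eq_sign (fromCols X₂ Y₂) ε ε₀]
  constructor
  · field_simp
  · rw [abs_mul, abs_mul]
    rcases Int.units_eq_one_or (Equiv.Perm.sign (ε.trans ε₀.symm)) with h | h <;> simp [h]

/-- The derivative of `∏ l, (z - k l)` at `z = k m`. -/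
def nodeWeight (k : Fin M → ℝ) (m : Fin M) : ℝ := ∏ l ∈ Finset.univ.erase m, (k m - k l)

theorem nodeWeight_ne_zero {k : Fin M → ℝ} (hk : Function.Injective k) (m : Fin M) :
    nodeWeight k m ≠ 0 :=
  Finset.prod_ne_zero_iff.2 fun _ hl => sub_ne_zero.2 (hk.ne (Finset.ne_of_mem_erase hl).symm)

/-- The sum is the coefficient of `X ^ (M - 1)` in the Lagrange interpolant of `X ^ n`, which is `X
^ n` itself. It makes the Vandermonde rows orthogonal to the weighted powers. -/
theorem sum_pow_div_nodeWeight {k : Fin M → ℝ} (hk : Function.Injective k) {n : ℕ}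
    (hn : n + 1 < M) : ∑ m, k m ^ n / nodeWeight k m = 0 := by
  have h := Lagrange.coeff_eq_sum (s := (Finset.univ : Finset (Fin M))) (v := k) hk.injOn
    (P := (Polynomial.X : Polynomial ℝ) ^ n) (by
      rw [Polynomial.degree_X_pow, Finset.card_univ, Fintype.card_fin]
      exact_mod_cast (by omega : n < M))
  simp only [Polynomial.eval_pow, Polynomial.eval_X, Polynomial.coeff_X_pow, Finset.card_univ,
    Fintype.card_fin] at h
  rw [if_neg (by omega)] at h
  exact h.symm

/-- The rows of `B` span the orthogonal complement of the rows of `A` after rescaling the columns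
by the weights of the nodes, which makes its minors proportional to the complementary minors
of `A` with constant sign. -/
theorem exists_complementary_matrix {k : Fin M → ℝ} (hk : StrictMono k)
    {A : Matrix (Fin N) (Fin M) ℝ} {S₀ : Finset (Fin M)} (h₀ : S₀.card = N) (h₀' : S₀ᶜ.card = N')
    (hA : A.submatrix id (S₀.orderEmbOfFin h₀) = 1) :
    ∃ (B : Matrix (Fin N') (Fin M) ℝ) (ρ d : ℝ), ρ ≠ 0 ∧ 0 < d ∧
      ∀ (S : Finset (Fin M)) (h : S.card = N) (h' : Sᶜ.card = N'),
        minor B (Sᶜ.orderEmbOfFin h') * vander k (S.orderEmbOfFin h) =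
          ρ * minor A (S.orderEmbOfFin h) * vander k (Sᶜ.orderEmbOfFin h') ∧
        vander k (S.orderEmbOfFin h) * d * ∏ m ∈ Sᶜ, |nodeWeight k m| =
          vander k (Sᶜ.orderEmbOfFin h') := by
  have hM : N + N' = M := by
    have := Finset.card_add_card_compl S₀
    rw [h₀, h₀', Fintype.card_fin] at this
    exact this
  have hinl : ∀ (S : Finset (Fin M)) (h : S.card = N) (h' : Sᶜ.card = N'),
      finSumEquivOfFinset h h' ∘ Sum.inl = S.orderEmbOfFin h := fun S h h' => by
    ext i; simp
  have hinr : ∀ (S : Finset (Fin M)) (h : S.card = N) (h' : Sᶜ.card = N'),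
      finSumEquivOfFinset h h' ∘ Sum.inr = Sᶜ.orderEmbOfFin h' := fun S h h' => by
    ext i; simp
  set ε₀ := finSumEquivOfFinset h₀ h₀' with hε₀
  let A₂ : Matrix (Fin N) (Fin M) ℝ := of fun j m => k m ^ (j : ℕ)
  let Y₂ : Matrix (Fin M) (Fin N') ℝ := of fun m j => k m ^ (j : ℕ) / nodeWeight k m
  -- The standard kernel basis: `A` is the identity on `S₀`, so stack minus its remaining columns on
  -- an identity block.
  let Y : Matrix (Fin M) (Fin N') ℝ :=
    (fromRows (-A.submatrix id (ε₀ ∘ Sum.inr)) 1).submatrix ε₀.symm id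
  have hw := nodeWeight_ne_zero hk.injective
  have hA₂det : ∀ m : Fin N → Fin M, (A₂.submatrix id m).det = vander k m := fun m => by
    rw [vander_eq_det]; rfl
  have hY₂det : ∀ l : Fin N' → Fin M, (Y₂.submatrix l id).det * ∏ i, nodeWeight k (l i) =
      vander k l := fun l => by
    rw [vander_eq_det, ← det_transpose (Y₂.submatrix l id), mul_comm, ← det_mul_row]
    congr 1
    ext i j
    simp only [of_apply, transpose_apply, submatrix_apply, id, Y₂]
    have := hw (l j)
    field_simp
  have hA' : A.submatrix id (ε₀ ∘ Sum.inl) = 1 := by rw [hε₀, hinl, hA]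
  obtain ⟨X, hX⟩ : ∃ X : Matrix (Fin M) (Fin N) ℝ, A * X = 1 :=
    exists_right_inverse (m := ε₀ ∘ Sum.inl) (by rw [hA', det_one]; exact one_ne_zero)
  obtain ⟨X₂, hX₂⟩ : ∃ X : Matrix (Fin M) (Fin N) ℝ, A₂ * X = 1 :=
    exists_right_inverse (m := S₀.orderEmbOfFin h₀) (by
      rw [hA₂det]; exact (vander_pos hk (S₀.orderEmbOfFin h₀).strictMono).ne')
  have hY : A * Y = 0 := by
    ext i j
    simp only [mul_apply, Y, submatrix_apply, id]
    rw [← Equiv.sum_comp ε₀, Fintype.sum_sum_type]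
    have : ∀ x, A i (ε₀ (Sum.inl x)) = if i = x then 1 else 0 := fun x => by
      have := congrFun (congrFun hA' i) x
      simpa [one_apply] using this
    simp [this, one_apply]
  have hY₂ : A₂ * Y₂ = 0 := by
    ext i j
    simp only [mul_apply, A₂, Y₂, of_apply, Matrix.zero_apply]
    rw [← sum_pow_div_nodeWeight hk.injective (n := (i : ℕ) + j) (by omega)]
    exact Finset.sum_congr rfl fun m _ => by rw [pow_add, mul_div_assoc]
  obtain ⟨ρ, d, hρ, hd, h⟩ := exists_det_mul_det_eq hX hY hX₂ hY₂ ε₀ (by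
    have : Y.submatrix (ε₀ ∘ Sum.inr) id = 1 := by
      ext i j
      simp [Y]
    rw [this, det_one]
    exact one_ne_zero) (by
    rw [hε₀, hinr]
    refine left_ne_zero_of_mul (b := ∏ i, nodeWeight k (S₀ᶜ.orderEmbOfFin h₀' i)) ?_
    rw [hY₂det]
    exact (vander_pos hk (S₀ᶜ.orderEmbOfFin h₀').strictMono).ne')
  refine ⟨of fun n m => nodeWeight k m * Y m n, ρ, d, hρ, hd, fun S hS hS' => ?_⟩
  obtain ⟨e1, e2⟩ := h (finSumEquivOfFinset hS hS')
  rw [hinl, hinr, hA₂det] at e1 e2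
  have e3 := hY₂det (Sᶜ.orderEmbOfFin hS')
  constructor
  · have : minor (of fun n m => nodeWeight k m * Y m n) (Sᶜ.orderEmbOfFin hS') =
        (∏ i, nodeWeight k (Sᶜ.orderEmbOfFin hS' i)) *
          (Y.submatrix (Sᶜ.orderEmbOfFin hS') id).det := by
      rw [minor, ← det_transpose (Y.submatrix _ _), ← det_mul_row]
      rfl
    rw [this, mul_assoc, e1, ← e3, minor]
    ring
  · have e4 : ∏ m ∈ Sᶜ, |nodeWeight k m| = |∏ i, nodeWeight k (Sᶜ.orderEmbOfFin hS' i)| := by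
      rw [Finset.abs_prod]
      conv_lhs => rw [← Finset.map_orderEmbOfFin_univ Sᶜ hS', Finset.prod_map]
      rfl
    rw [abs_of_pos (vander_pos hk (S.orderEmbOfFin hS).strictMono)] at e2
    rw [e4, e2, ← abs_mul, e3, abs_of_pos (vander_pos hk (Sᶜ.orderEmbOfFin hS').strictMono)]

end ComplementaryMinors

section RowReduction

variable {N M : ℕ}

theorem isColBasis_iff_minor {A : Matrix (Fin N) (Fin M) ℝ} {S : Finset (Fin M)}
    (h : S.card = N) : IsColBasis (cols A) S ↔ minor A (S.orderEmbOfFin h) ≠ 0 := by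
  rw [minor_ne_zero_iff, Finset.map_orderEmbOfFin_univ]

/-- A matrix of full rank is row equivalent to a matrix in reduced row-echelon form. -/
theorem exists_isRREF {A : Matrix (Fin N) (Fin M) ℝ} {S : Finset (Fin M)}
    (hS : IsColBasis (cols A) S) :
    ∃ (B : Matrix (Fin N) (Fin M) ℝ) (c : ℝ), c ≠ 0 ∧ B.rank = N ∧ IsRREF B ∧
      (∃ (T : Finset (Fin M)) (h : T.card = N), minor B (T.orderEmbOfFin h) = 1) ∧
      ∀ m, minor B m = c * minor A m := by
  classical
  -- The basis of least index sum consists of the pivots: after normalizing these columns to the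
  -- identity, a nonzero entry left of a pivot would allow an exchange lowering the sum.
  obtain ⟨T, hT, hmin⟩ := Finset.exists_min_image
    (Finset.univ.filter fun S : Finset (Fin M) => IsColBasis (cols A) S)
    (fun S => ∑ m ∈ S, (m : ℕ)) ⟨S, by simpa using hS⟩
  simp only [Finset.mem_filter, Finset.mem_univ, true_and] at hT hmin
  set t := T.orderEmbOfFin hT.1 with ht
  have hdet : minor A t ≠ 0 := (isColBasis_iff_minor hT.1).1 hT
  set B := (A.submatrix id t)⁻¹ * A with hB
  have hBsub : ∀ m : Fin N → Fin M, B.submatrix id m = (A.submatrix id t)⁻¹ * A.submatrix id m := by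
    intro m
    ext i j
    simp [hB, mul_apply]
  have hBt : B.submatrix id t = 1 := by
    rw [hBsub, nonsing_inv_mul _ (isUnit_iff_ne_zero.2 hdet)]
  have hminor : ∀ m, minor B m = (minor A t)⁻¹ * minor A m := by
    intro m
    rw [minor, hBsub, det_mul, det_nonsing_inv, Ring.inverse_eq_inv']
    rfl
  have hBt' : ∀ n n', B n (t n') = if n = n' then 1 else 0 := fun n n' => by
    have := congrFun (congrFun hBt n) n'
    simpa [one_apply] using this
  have hbasis : ∀ S, IsColBasis (cols B) S ↔ IsColBasis (cols A) S := by
    intro S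
    by_cases h : S.card = N
    · rw [isColBasis_iff_minor h, isColBasis_iff_minor h, hminor]
      exact mul_ne_zero_iff_left (inv_ne_zero hdet)
    · exact ⟨fun h' => absurd h'.1 h, fun h' => absurd h'.1 h⟩
  have hlead : ∀ n, IsLeading B n (t n) := by
    refine fun n => ⟨by rw [hBt', if_pos rfl]; exact one_ne_zero, fun m hm => ?_⟩
    by_contra hne
    have htT : t n ∈ T := T.orderEmbOfFin_mem hT.1 n
    have hspan : cols B m ∉ span ℝ (cols B '' ((T : Set (Fin M)) \ {t n})) := by
      refine notMem_span_of_row hne ?_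
      rintro x ⟨hx, hxn⟩
      have hx' : x ∈ Set.range t := by rw [ht, Finset.range_orderEmbOfFin]; exact hx
      obtain ⟨n', rfl⟩ := hx'
      rw [hBt', if_neg]
      rintro rfl
      exact hxn rfl
    have h1 := hmin _ ((hbasis _).1 (((hbasis T).2 hT).exchange htT hspan))
    have hmT : m ∉ T.erase (t n) := fun h => hspan (subset_span ⟨m, by
      simpa [and_comm] using h, rfl⟩)
    rw [Finset.sum_insert hmT, ← Finset.add_sum_erase T _ htT] at h1
    have : (m : ℕ) < t n := hm
    omega
  have huniq : ∀ n m, IsLeading B n m → m = t n := by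
    intro n m hm
    rcases lt_trichotomy m (t n) with h | h | h
    · exact absurd ((hlead n).2 m h) hm.1
    · exact h
    · exact absurd (hm.2 _ h) (hlead n).1
  refine ⟨B, (minor A t)⁻¹, inv_ne_zero hdet, ?_, ⟨?_, ?_, ?_, ?_⟩, ⟨T, hT.1, ?_⟩, hminor⟩
  · refine le_antisymm (by simpa using B.rank_le_height) ?_
    have h1 : B * (1 : Matrix (Fin M) (Fin M) ℝ).submatrix id t = 1 := by
      rw [← hBt]
      ext i j
      simp [mul_apply, one_apply]
    have h2 := rank_mul_le_left B ((1 : Matrix (Fin M) (Fin M) ℝ).submatrix id t)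
    rw [h1, rank_one, Fintype.card_fin] at h2
    exact h2
  · intro n m hm
    rw [huniq n m hm, hBt', if_pos rfl]
  · intro n m hm n' hn
    rw [huniq n m hm, hBt', if_neg hn]
  · intro n n' m m' hn hm hm'
    rw [huniq n m hm, huniq n' m' hm']
    exact t.strictMono hn
  · intro n n' _ h
    exact absurd (h (t n)) (hlead n).1
  · rw [← ht, minor, hBt, det_one]

theorem isIrreducible_of_bases {A : Matrix (Fin N) (Fin M) ℝ} (h : A.rank = N) (hA : IsRREF A)
    (h₁ : ∀ m, ∃ S, IsColBasis (cols A) S ∧ m ∈ S)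
    (h₂ : ∀ m, ∃ S, IsColBasis (cols A) S ∧ m ∉ S) : IsIrreducible A := by
  constructor
  · intro m
    obtain ⟨S, hS, hm⟩ := h₁ m
    by_contra! hz
    exact hS.notMem_span hm (X := ∅) (by simp) (by simp) (by
      rw [show cols A m = 0 from funext hz]; exact zero_mem _)
  · intro n
    obtain ⟨e, -, he, -⟩ := exists_pivots h hA
    obtain ⟨S, hS, hm⟩ := h₂ (e n)
    by_contra! hz
    refine notMem_span_of_row (he n).1 (X := (S : Set (Fin M))) (fun m hmS => ?_)
      (hS.mem_span_image (cols A (e n)))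
    by_contra hne
    have hl := hz m hne
    rcases lt_trichotomy m (e n) with h | h | h
    · exact hne ((he n).2 m h)
    · subst h
      exact hm hmS
    · exact (he n).1 (hl.2 _ h)

end RowReduction

namespace TauData

variable {N M : ℕ} {D : TauData N M}

/-- For elastic data there are dual data whose `τ`-function is that of the inverted solution. -/
theorem IsElastic.exists_dual (hD : D.Admissible) (h : D.IsElastic) :
    ∃ D' : TauData N M, D'.k = D.k ∧ D'.Admissible ∧ D'.phaseSet = D.phaseSet ∧
      ∃ K : ℝ, 0 < K ∧ ∀ S, D'.setCoeff S * Real.exp (∑ m ∈ S, D'.θ₀ m) =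
        K * (D.setCoeff Sᶜ * Real.exp (∑ m ∈ Sᶜ, D.θ₀ m)) := by
  have hM := h.eq_two_mul hD
  have hel := (isElastic_iff_compl hD).1 h
  have hel' : ∀ S, IsColBasis (cols D.A) Sᶜ ↔ IsColBasis (cols D.A) S := fun S =>
    ⟨fun h => by simpa using hel _ h, hel S⟩
  have hcard : ∀ S : Finset (Fin M), S.card = N → Sᶜ.card = N := fun S hS => by
    rw [Finset.card_compl, hS, Fintype.card_fin]; omega
  obtain ⟨e, hmono, he, -⟩ := exists_pivots hD.rank hD.rref
  have hP := isColBasis_pivots hD.rref hmono he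
  obtain ⟨B₀, ρ, d, hρ, hd, hB₀⟩ := exists_complementary_matrix hD.strictMono hP.1 (hcard _ hP.1)
    (A := D.A) (by
      rw [orderEmbOfFin_map_univ]
      ext n n'
      simp [apply_pivot hD.rref he, one_apply])
  have hV := fun (S : Finset (Fin M)) (hS : S.card = N) =>
    vander_pos hD.strictMono (S.orderEmbOfFin hS).strictMono
  have hB₀' : ∀ (S : Finset (Fin M)) (hS : S.card = N),
      minor B₀ (S.orderEmbOfFin hS) * vander D.k (Sᶜ.orderEmbOfFin (hcard S hS)) =
        ρ * minor D.A (Sᶜ.orderEmbOfFin (hcard S hS)) * vander D.k (S.orderEmbOfFin hS) ∧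
      vander D.k (Sᶜ.orderEmbOfFin (hcard S hS)) * d * ∏ m ∈ S, |nodeWeight D.k m| =
        vander D.k (S.orderEmbOfFin hS) := by
    intro S hS
    have := hB₀ Sᶜ (hcard S hS) (by rwa [compl_compl])
    simpa only [compl_compl] using this
  have hbasis₀ : ∀ S, IsColBasis (cols B₀) S ↔ IsColBasis (cols D.A) S := by
    intro S
    by_cases hS : S.card = N
    · rw [← hel', isColBasis_iff_minor hS, isColBasis_iff_minor (hcard S hS)]
      have h1 := (hB₀' S hS).1
      have h2 := (hV S hS).ne'
      have h3 := (hV _ (hcard S hS)).ne'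
      rw [← mul_ne_zero_iff_right h3, h1, mul_ne_zero_iff_right h2, mul_ne_zero_iff_left hρ]
    · exact ⟨fun h' => absurd h'.1 hS, fun h' => absurd h'.1 hS⟩
  obtain ⟨B, c, hc, hrank, hrref, ⟨T, hT, hBT⟩, hB⟩ := exists_isRREF ((hbasis₀ _).2 hP)
  have hbasis : ∀ S, IsColBasis (cols B) S ↔ IsColBasis (cols D.A) S := by
    intro S
    rw [← hbasis₀]
    by_cases hS : S.card = N
    · rw [isColBasis_iff_minor hS, isColBasis_iff_minor hS, hB, mul_ne_zero_iff_left hc]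
    · exact ⟨fun h' => absurd h'.1 hS, fun h' => absurd h'.1 hS⟩
  have hBminor : ∀ (S : Finset (Fin M)) (hS : S.card = N), minor B (S.orderEmbOfFin hS) =
      c * ρ * (minor D.A (Sᶜ.orderEmbOfFin (hcard S hS)) * (vander D.k (S.orderEmbOfFin hS) /
        vander D.k (Sᶜ.orderEmbOfFin (hcard S hS)))) := by
    intro S hS
    rw [hB, mul_assoc]
    congr 1
    have := (hB₀' S hS).1
    have h3 := (hV _ (hcard S hS)).ne'
    field_simp
    linear_combination this
  have hnonneg : ∀ m, 0 ≤ minor D.A m := fun m => by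
    by_contra hlt
    exact hlt (hD.minor_pos m (fun h => hlt h.ge)).le
  -- The signs of `c` and `ρ` are unknown separately; the minor equal to 1 at `T` fixes that of the
  -- product.
  have hpos : 0 < c * ρ := by
    have h1 := hBminor T hT
    rw [hBT] at h1
    have h2 : 0 ≤ minor D.A (Tᶜ.orderEmbOfFin (hcard T hT)) * (vander D.k (T.orderEmbOfFin hT) /
        vander D.k (Tᶜ.orderEmbOfFin (hcard T hT))) :=
      mul_nonneg (hnonneg _) (div_pos (hV T hT) (hV _ (hcard T hT))).le
    by_contra hle
    have := mul_nonpos_of_nonpos_of_nonneg (not_lt.1 hle) h2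
    linarith
  have hw := nodeWeight_ne_zero hD.strictMono.injective
  -- The coefficient at `S` for `B` is that of `D` at `Sᶜ` times the square of a Vandermonde ratio,
  -- namely of `d * ∏ m ∈ S, |nodeWeight D.k m|`. The logarithmic shift absorbs the node weights and
  -- leaves `d ^ 2` in the constant.
  let D' : TauData N M := ⟨D.k, fun m => -D.θ₀ m - 2 * Real.log |nodeWeight D.k m|, B⟩
  have hD' : D'.Admissible := by
    refine ⟨hD.strictMono, hD.lt, hrank, fun m hm => ?_, hrref, ?_⟩
    · change minor B m ≠ 0 at hm
      change 0 < minor B m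
      have hcm : (Finset.univ.map m.toEmbedding).card = N := by simp
      have h1 := hBminor _ hcm
      rw [orderEmbOfFin_map_univ] at h1
      refine lt_of_le_of_ne ?_ (Ne.symm hm)
      rw [h1]
      refine mul_nonneg hpos.le (mul_nonneg (hnonneg _) (div_pos ?_ (hV _ (hcard _ hcm))).le)
      exact vander_pos hD.strictMono m.strictMono
    · have := fun m => exists_isColBasis_mem hD.rank hD.rref hD.irreducible m
      simp only [← hbasis] at this
      exact isIrreducible_of_bases hrank hrref (fun m => (this m).1) fun m => (this m).2
  refine ⟨D', rfl, hD', ?_, c * ρ * d ^ 2 * Real.exp (-∑ m, D.θ₀ m), by positivity, fun S => ?_⟩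
  · ext S
    rw [mem_phaseSet_iff_isColBasis hD.strictMono, mem_phaseSet_iff_isColBasis hD'.strictMono]
    exact hbasis S
  · by_cases hS : S.card = N
    · have h1 : D'.setCoeff S =
          minor B (S.orderEmbOfFin hS) * vander D.k (S.orderEmbOfFin hS) := by
        rw [setCoeff, dif_pos hS]; rfl
      have h2 : D.setCoeff Sᶜ = minor D.A (Sᶜ.orderEmbOfFin (hcard S hS)) *
          vander D.k (Sᶜ.orderEmbOfFin (hcard S hS)) := by
        rw [setCoeff, dif_pos (hcard S hS)]; rfl
      have h3 : Real.exp (∑ m ∈ S, D'.θ₀ m) * (∏ m ∈ S, |nodeWeight D.k m|) ^ 2 =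
          Real.exp (-∑ m, D.θ₀ m) * Real.exp (∑ m ∈ Sᶜ, D.θ₀ m) := by
        have h4 : (∏ m ∈ S, |nodeWeight D.k m|) ^ 2 =
            Real.exp (∑ m ∈ S, 2 * Real.log |nodeWeight D.k m|) := by
          rw [Real.exp_sum, ← Finset.prod_pow]
          refine Finset.prod_congr rfl fun m _ => ?_
          rw [two_mul, Real.exp_add, Real.exp_log (abs_pos.2 (hw m)), sq]
        rw [h4, ← Real.exp_add, ← Real.exp_add, ← Finset.sum_add_sum_compl S D.θ₀,
          ← Finset.sum_add_distrib]
        congr 1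
        simp [D', Finset.sum_neg_distrib]
      have h5 := (hB₀' S hS).2
      rw [h1, h2, hBminor]
      have h6 := (hV _ (hcard S hS)).ne'
      rw [← h5]
      field_simp
      linear_combination (minor D.A (Sᶜ.orderEmbOfFin (hcard S hS))) * h3
    · have h1 : D'.setCoeff S = 0 := setCoeff_eq_zero hD' fun h' => hS h'.1
      have h2 : D.setCoeff Sᶜ = 0 := setCoeff_eq_zero hD fun h' => hS ((hel' S).1 h').1
      rw [h1, h2]
      simp

theorem phaseSum_eq (S : Finset (Fin M)) (x y t : ℝ) :
    D.phaseSum S x y t = ∑ m ∈ S, linPhase (D.k m) x y t + ∑ m ∈ S, D.θ₀ m := by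
  rw [← Finset.sum_add_distrib]
  rfl

theorem iteratedDeriv_two_eq {F F₁ F₂ : ℝ → ℝ} (h₁ : ∀ x, HasDerivAt F (F₁ x) x)
    (h₂ : ∀ x, HasDerivAt F₁ (F₂ x) x) (x : ℝ) : iteratedDeriv 2 F x = F₂ x := by
  rw [iteratedDeriv_succ, iteratedDeriv_one, funext fun x => (h₁ x).deriv, (h₂ x).deriv]

/-- Inverting all variables turns `θ(Sᶜ)` into `θ(S)` minus the total phase, up to phase constants.
So the dual `τ` is the inverted one times an exponential of an affine function of `x`, and the
logarithms have equal second derivatives. -/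
theorem IsElastic.sol_neg_mem (hD : D.Admissible) (h : D.IsElastic) :
    (fun x y t => D.sol (-x) (-y) (-t)) ∈ D.solutionClass := by
  obtain ⟨D', hk, hD', hphase, K, hK, hcoeff⟩ := h.exists_dual hD
  refine ⟨N, D', hD', ⟨hk.symm, 0, by rw [hphase]; simp⟩, ?_⟩
  have htau : ∀ x y t, D'.tau x y t =
      K * Real.exp (∑ m, linPhase (D.k m) x y t) * D.tau (-x) (-y) (-t) := by
    intro x y t
    rw [tau_eq_sum, tau_eq_sum, ← Equiv.sum_comp (Function.Involutive.toPerm (α := Finset (Fin M)) _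
      compl_involutive) (fun S =>
      D.setCoeff S * Real.exp (D.phaseSum S (-x) (-y) (-t))), Finset.mul_sum]
    refine Finset.sum_congr rfl fun S _ => ?_
    simp only [Function.Involutive.coe_toPerm, phaseSum_eq, hk]
    have h1 : ∑ m ∈ Sᶜ, linPhase (D.k m) (-x) (-y) (-t) =
        ∑ m ∈ S, linPhase (D.k m) x y t - ∑ m, linPhase (D.k m) x y t := by
      rw [← Finset.sum_add_sum_compl S, sub_add_cancel_left, ← Finset.sum_neg_distrib]
      exact Finset.sum_congr rfl fun m _ => by unfold linPhase; ring
    rw [h1, Real.exp_add, Real.exp_add, Real.exp_sub]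
    have h2 := Real.exp_pos (∑ m, linPhase (D.k m) x y t)
    field_simp
    linear_combination hcoeff S
  funext x y t
  have hne : ∀ x, D.tauDeriv 0 x (-y) (-t) ≠ 0 := fun x => by
    rw [tauDeriv_zero]; exact (tau_pos hD x _ _).ne'
  have h1 : ∀ x, HasDerivAt (fun x' => Real.log (D.tau x' (-y) (-t)))
      (D.tauDeriv 1 x (-y) (-t) / D.tauDeriv 0 x (-y) (-t)) x := fun x => by
    simp only [← tauDeriv_zero]
    exact (hasDerivAt_tauDeriv 0 x (-y) (-t)).log (hne x)
  have h2 := fun x =>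
    (hasDerivAt_tauDeriv (D := D) 1 x (-y) (-t)).fun_div (hasDerivAt_tauDeriv 0 x (-y) (-t)) (hne x)
  have hlog : (fun x' => Real.log (D'.tau x' y t)) = fun x' =>
      Real.log K + ∑ m, linPhase (D.k m) x' y t + Real.log (D.tau (-x') (-y) (-t)) := by
    funext x'
    rw [htau, Real.log_mul (mul_pos hK (Real.exp_pos _)).ne' (tau_pos hD _ _ _).ne',
      Real.log_mul hK.ne' (Real.exp_pos _).ne', Real.log_exp]
  have hlin : ∀ x, HasDerivAt (fun x' => Real.log K + ∑ m, linPhase (D.k m) x' y t)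
      (∑ m, D.k m) x := by
    intro x
    refine HasDerivAt.const_add _ (HasDerivAt.fun_sum fun m _ => ?_)
    have := (((hasDerivAt_id x).const_mul (D.k m)).add_const (D.k m ^ 2 * y)).add_const
      (D.k m ^ 3 * t)
    simpa [linPhase] using this
  have h3 := fun x => (hlin x).fun_add ((h1 (-x)).comp x (hasDerivAt_neg x))
  have h4 := fun x => ((hasDerivAt_const x (∑ m, D.k m)).fun_add
    (((h2 (-x)).comp x (hasDerivAt_neg x)).mul_const (-1)))
  change D.sol (-x) (-y) (-t) = D'.sol x y t
  have h5 := iteratedDeriv_two_eq h3 h4 x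
  simp only [Function.comp_def] at h5
  rw [sol, sol, hlog, iteratedDeriv_two_eq h1 h2, h5]
  ring

end TauData

end KPII

end

/-! ### Assembly of the four claims. -/

theorem proposition3 {N M : ℕ} (D : KPII.TauData N M) (hD : D.Admissible) :
    (D.IsElastic ↔ M = 2 * N ∧ KPII.MinorDuality D.A) ∧
    (D.IsElastic →
      (D.sol ∈ D.solutionClass ∧
        (fun x y t => D.sol (-x) (-y) (-t)) ∈ D.solutionClass) ∧
      ∃ e g : Fin N → Fin M,
        StrictMono e ∧ Function.Injective g ∧ (∀ n, e n < g n) ∧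
        Set.range e = {m | KPII.IsPivot D.A m} ∧
        Set.range g = {m | ¬ KPII.IsPivot D.A m} ∧
        IsCompl (Set.range e) (Set.range g) ∧
        {p : Fin M × Fin M | D.IsTransition atTop p.1 p.2} =
          Set.range (fun n => (e n, g n)) ∧
        {p : Fin M × Fin M | D.IsTransition atBot p.1 p.2} =
          Set.range (fun n => (e n, g n)) ∧
        (Function.Injective (fun n => D.k (e n) + D.k (g n)) →
          {p : Fin M × Fin M | D.IsAsymptoticLineSoliton atTop p.1 p.2} =
            Set.range (fun n => (e n, g n)) ∧
          {p : Fin M × Fin M | D.IsAsymptoticLineSoliton atBot p.1 p.2} =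
            Set.range (fun n => (e n, g n)) ∧
          {q : ℝ × ℝ | KPII.HasLineSoliton D.sol atTop q.1 q.2} =
            Set.range (fun n => (D.k (g n) - D.k (e n), D.k (g n) + D.k (e n))) ∧
          {q : ℝ × ℝ | KPII.HasLineSoliton D.sol atBot q.1 q.2} =
            Set.range (fun n => (D.k (g n) - D.k (e n), D.k (g n) + D.k (e n))))) := by
  refine ⟨KPII.TauData.isElastic_iff hD, fun h => ⟨⟨?_, h.sol_neg_mem hD⟩, ?_⟩⟩
  · exact ⟨N, D, hD, ⟨rfl, 0, by simp⟩, rfl⟩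
  obtain ⟨e, g, he, hg, heg, hre, hrg, hcompl, htop, hbot⟩ := h.exists_pairing hD
  refine ⟨e, g, he, hg, heg, hre, hrg, hcompl, htop, hbot, fun hinj => ?_⟩
  obtain ⟨t₁, t₂⟩ := KPII.TauData.lineSolitons_eq hD (by norm_num)
    KPII.TauData.tendsto_one_mul_atTop htop hinj
  obtain ⟨b₁, b₂⟩ := KPII.TauData.lineSolitons_eq hD (by norm_num)
    KPII.TauData.tendsto_neg_one_mul_atBot hbot hinj
  exact ⟨t₁, b₁, t₂, b₂⟩
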